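/- Let $\mathbb D$ be the open unit disc, $\mathbb T=\partial\mathbb D$, $dA=\pi^{-1}dx\,dy$, let $\mathrm{Aut}(\mathbb D)$ be the set of one-to-one analytic maps of $\mathbb D$ onto itself, and let $\sigma_a(z)=\frac{a-z}{1-\overline a z}$. Let $\mu$ be a positive Borel measure on $\mathbb D$, and for $z\in\mathbb D$ put $$U_\mu(z)=\int_{\mathbb D}\log\left|\frac{1-\overline w z}{z-w}\right|^2d\mu(w),\qquad V_\mu(z)=\int_{\mathbb D}\bigl(1-|\sigma_z(w)|^2\bigr)\,d\mu(w),$$ both with values in $[0,\infty]$ (the integrand of $U_\mu$ is $+\infty$ at $w=z$). Let $M(\mathcal D_\mu)$ be the space of all analytic functions $f$ on $\mathbb D$ with $$\|f\|_{M(\mathcal D_\mu)}=|f(0)|+\sup_{\phi\in\mathrm{Aut}(\mathbb D)}\left(\int_{\mathbb D}|f'(w)|^2\,U_\mu(\phi(w))\,dA(w)\right)^{1/2}<\infty,$$ with the convention $0\cdot\infty=0$. Let $H^\infty$ be the space of bounded analytic functions on $\mathbb D$, and for $f(z)=\sum_{k\ge0}a_kz^k$ in $H^\infty$ let $$\mathcal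 H(f)(z)=\sum_{n=0}^\infty\left(\sum_{k=0}^\infty\frac{a_k}{k+n+1}\right)z^n,\qquad z\in\mathbb D.$$ Then the following conditions are equivalent: (i) $\mathcal H(f)\in M(\mathcal D_\mu)$ for every $f\in H^\infty$; (ii) the function $z\mapsto\log(1-z)$ (principal branch) belongs to $M(\mathcal D_\mu)$; (iii) $\displaystyle\sup_{\lambda\in\mathbb T}\int_{\mathbb D}\frac{V_\mu(z)}{|1-\lambda z|^2}\,dA(z)<\infty$; (iv) $\displaystyle\sup_{a\in\mathbb D}\int_{\mathbb D}\frac{V_\mu(z)}{|1-az|^2}\,dA(z)<\infty$. -/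

import Mathlib

open MeasureTheory
open scoped ENNReal ComplexConjugate

noncomputable section

namespace HilbertMatrix

/-- The open unit disc `𝔻`. -/
abbrev disc : Set ℂ := Metric.ball (0 : ℂ) 1

/-- The unit circle `𝕋`. -/
abbrev circle : Set ℂ := Metric.sphere (0 : ℂ) 1

/-- Normalised area measure on the disc, `dA = π⁻¹ dx dy`. -/
def area : Measure ℂ := (ENNReal.ofReal Real.pi)⁻¹ • (volume : Measure ℂ).restrict disc

/-- The Möbius map `σ_a(z) = (a - z) / (1 - \bar a z)`. -/
def sigma (a z : ℂ) : ℂ := (a - z) / (1 - conj a * z)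

/-- `φ ∈ Aut(𝔻)`: analytic on the disc, one-to-one, and mapping the disc onto itself.
Functions on the disc are represented by functions on `ℂ` whose values off the disc are ignored. -/
def IsDiscAut (φ : ℂ → ℂ) : Prop :=
  DifferentiableOn ℂ φ disc ∧ Set.BijOn φ disc disc

/-- `f ∈ H^∞`: bounded and analytic on the disc. -/
def MemHInfty (f : ℂ → ℂ) : Prop :=
  DifferentiableOn ℂ f disc ∧ ∃ C : ℝ, ∀ z ∈ disc, ‖f z‖ ≤ C

/-- The `k`-th Taylor coefficient of `f` at the origin. -/
def taylorCoeff (f : ℂ → ℂ) (k : ℕ) : ℂ := iteratedDeriv k f 0 / (k.factorial : ℂ)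

/-- The Hilbert matrix operator `H(f)(z) = ∑ₙ (∑ₖ aₖ / (k + n + 1)) zⁿ`, where the `aₖ` are the
Taylor coefficients of `f`. For `f ∈ H^∞` and `z` in the disc both series converge absolutely. -/
def hilbert (f : ℂ → ℂ) (z : ℂ) : ℂ :=
  ∑' n : ℕ, (∑' k : ℕ, taylorCoeff f k / ((k : ℂ) + (n : ℂ) + 1)) * z ^ n

/-- The kernel `log |(1 - \bar w z) / (z - w)|²`, with value `+∞` at `z = w`.
It is nonnegative for `z`, `w` in the disc. -/
def greenKernel (z w : ℂ) : ℝ≥0∞ :=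
  open Classical in
  if z = w then ⊤ else ENNReal.ofReal (Real.log (‖(1 - conj w * z) / (z - w)‖ ^ 2))

/-- `U_μ(z) = ∫_𝔻 log |(1 - \bar w z) / (z - w)|² dμ(w)`, with values in `[0, ∞]`. A Borel measure
on the disc is given by a Borel measure on `ℂ`, of which only the restriction to the disc is used. -/
def U (μ : Measure ℂ) (z : ℂ) : ℝ≥0∞ :=
  ∫⁻ w in disc, greenKernel z w ∂μ

/-- `V_μ(z) = ∫_𝔻 (1 - |σ_z(w)|²) dμ(w)`, with values in `[0, ∞]`. -/
def V (μ : Measure ℂ) (z : ℂ) : ℝ≥0∞ :=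
  ∫⁻ w in disc, ENNReal.ofReal (1 - ‖sigma z w‖ ^ 2) ∂μ

/-- `‖f‖_{M(D_μ)} = |f(0)| + sup_{φ ∈ Aut(𝔻)} (∫_𝔻 |f'(w)|² U_μ(φ(w)) dA(w))^{1/2}`,
with values in `[0, ∞]`. -/
def normMD (μ : Measure ℂ) (f : ℂ → ℂ) : ℝ≥0∞ :=
  ‖f 0‖ₑ + ⨆ (φ : ℂ → ℂ) (_ : IsDiscAut φ),
    (∫⁻ w, ‖deriv f w‖ₑ ^ 2 * U μ (φ w) ∂area) ^ (1 / 2 : ℝ)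

/-- `f ∈ M(D_μ)`: analytic on the disc with finite norm. -/
def MemMD (μ : Measure ℂ) (f : ℂ → ℂ) : Prop :=
  DifferentiableOn ℂ f disc ∧ normMD μ f < ⊤

end HilbertMatrix

end

open HilbertMatrix

namespace HilbertMatrix
open Set Filter Topology

/-! Everything reduces to the weight `1/|1 - w|²`. Summing the series gives `H(f)(z) = ∫₀¹ f(t)/(1 -
tz) dt`. So for bounded `f` the derivative of `H(f)` is `O(1/|1 - w|)`, while `H(1)'` is bounded
below by a multiple of `1/|1 - w|`, which is the modulus of the derivative of `log(1 - z)`.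
Membership in `M(D_μ)` sees only `|f'|` and is monotone in it, hence (i) ⇔ (ii).

Testing (ii) on rotations, with `V ≤ U`, gives (iii). The bound `|1 - λz| ≤ 2|1 - rλz|` gives (iv),
and Fatou's lemma returns from (iv) to (iii).

The main step bounds the integral for every automorphism by those in (iii) and (iv). Substituting `z
= φ(w)` moves the automorphism from `U` to the weight, which becomes `|l - a|² / |(1 - az)(1 -
lz)|²` with `a` in the disc and `l` on the circle (`exists_boundary_point`). Against such weights
`U` is dominated by `V` (`exists_lintegral_quad_U_le`): by Tonelli it suffices to compare the
kernels, and since the family of weights is Möbius covariant the pole can be moved to the origin,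
where `log(1/|u|²)` is compared with `1 - |u|²`. Partial fractions then split the weight into `1/|1
- lz|²` and `1/|1 - az|²`. -/

theorem mem_disc {z : ℂ} : z ∈ disc ↔ ‖z‖ < 1 := by simp [disc]

/-! ### Möbius maps and the automorphisms of the disc. -/

theorem one_sub_mul_ne_zero {a z : ℂ} (ha : ‖a‖ ≤ 1) (hz : ‖z‖ < 1) : 1 - a * z ≠ 0 := by
  intro h
  have h1 : ‖a * z‖ = 1 := by rw [← sub_eq_zero.1 h]; simp
  rw [norm_mul] at h1
  nlinarith [norm_nonneg a, norm_nonneg z]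

theorem norm_one_sub_mul_pos {a z : ℂ} (ha : ‖a‖ ≤ 1) (hz : ‖z‖ < 1) : 0 < ‖1 - a * z‖ :=
  norm_pos_iff.2 (one_sub_mul_ne_zero ha hz)

theorem normSq_one_sub_conj_mul_sub (a z : ℂ) :
    ‖1 - conj a * z‖ ^ 2 - ‖a - z‖ ^ 2 = (1 - ‖a‖ ^ 2) * (1 - ‖z‖ ^ 2) := by
  simp only [← Complex.normSq_eq_norm_sq, Complex.normSq_apply, Complex.sub_re, Complex.sub_im,
    Complex.mul_re, Complex.mul_im, Complex.conj_re, Complex.conj_im, Complex.one_re,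
    Complex.one_im]
  ring

theorem one_sub_norm_sigma_sq {a z : ℂ} (ha : ‖a‖ ≤ 1) (hz : ‖z‖ < 1) :
    1 - ‖sigma a z‖ ^ 2 = (1 - ‖a‖ ^ 2) * (1 - ‖z‖ ^ 2) / ‖1 - conj a * z‖ ^ 2 := by
  have h := norm_one_sub_mul_pos (a := conj a) (by simpa using ha) hz
  rw [← normSq_one_sub_conj_mul_sub, sigma, norm_div, div_pow, sub_div, div_self (by positivity)]

theorem norm_sigma_lt_one {a z : ℂ} (ha : ‖a‖ < 1) (hz : ‖z‖ < 1) : ‖sigma a z‖ < 1 := by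
  have h := norm_one_sub_mul_pos (a := conj a) (by simpa using ha.le) hz
  have h1 := one_sub_norm_sigma_sq ha.le hz
  have h2 : 0 < (1 - ‖a‖ ^ 2) * (1 - ‖z‖ ^ 2) / ‖1 - conj a * z‖ ^ 2 := by
    have : 0 < 1 - ‖a‖ ^ 2 := by nlinarith [norm_nonneg a]
    have : 0 < 1 - ‖z‖ ^ 2 := by nlinarith [norm_nonneg z]
    positivity
  nlinarith [norm_nonneg (sigma a z)]

theorem norm_sigma_comm (a z : ℂ) : ‖sigma a z‖ = ‖sigma z a‖ := by
  rw [sigma, sigma, norm_div, norm_div, norm_sub_rev a z, ← Complex.norm_conj (1 - conj a * z)]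
  simp [mul_comm]

theorem one_sub_norm_sq_ne_zero {a : ℂ} (ha : ‖a‖ < 1) : 1 - conj a * a ≠ 0 :=
  one_sub_mul_ne_zero (by simpa using ha.le) ha

theorem one_sub_conj_mul_sigma {a z : ℂ} (ha : ‖a‖ < 1) (hz : ‖z‖ < 1) :
    1 - conj a * sigma a z = (1 - conj a * a) / (1 - conj a * z) := by
  have h := one_sub_mul_ne_zero (a := conj a) (by simpa using ha.le) hz
  rw [sigma]; field_simp; ring

theorem sigma_sigma {a z : ℂ} (ha : ‖a‖ < 1) (hz : ‖z‖ < 1) : sigma a (sigma a z) = z := by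
  have h := one_sub_mul_ne_zero (a := conj a) (by simpa using ha.le) hz
  have h0 := one_sub_norm_sq_ne_zero ha
  rw [sigma, one_sub_conj_mul_sigma ha hz, sigma, div_eq_iff (div_ne_zero h0 h), sub_div' h,
    mul_div_assoc']
  congr 1; ring

theorem bijOn_sigma {a : ℂ} (ha : ‖a‖ < 1) : BijOn (sigma a) disc disc := by
  have hm : MapsTo (sigma a) disc disc := fun z hz =>
    mem_disc.2 (norm_sigma_lt_one ha (mem_disc.1 hz))
  refine InvOn.bijOn ⟨fun z hz => ?_, fun z hz => ?_⟩ hm hm <;>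
  exact sigma_sigma ha (mem_disc.1 hz)

theorem hasDerivAt_sigma {a z : ℂ} (ha : ‖a‖ < 1) (hz : ‖z‖ < 1) :
    HasDerivAt (sigma a) (-(1 - conj a * a) / (1 - conj a * z) ^ 2) z := by
  have h := one_sub_mul_ne_zero (a := conj a) (by simpa using ha.le) hz
  have := ((hasDerivAt_id z).const_sub a).div
    (((hasDerivAt_id z).const_mul (conj a)).const_sub 1) h
  refine this.congr_deriv ?_
  simp only [id_eq]
  congr 1; ring

theorem isDiscAut_sigma {a : ℂ} (ha : ‖a‖ < 1) : IsDiscAut (sigma a) :=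
  ⟨fun _ hz => (hasDerivAt_sigma ha (mem_disc.1 hz)).differentiableAt.differentiableWithinAt,
    bijOn_sigma ha⟩

theorem isDiscAut_const_mul {η : ℂ} (hη : ‖η‖ = 1) : IsDiscAut (fun z => η * z) := by
  have h0 : η ≠ 0 := by rintro rfl; simp at hη
  refine ⟨by fun_prop, InvOn.bijOn (f' := fun z => η⁻¹ * z) ⟨fun z _ => ?_, fun z _ => ?_⟩
    (fun z hz => ?_) (fun z hz => ?_)⟩
  · simp [h0]
  · simp [h0]
  · simpa [hη] using hz
  · simpa [hη] using hz

theorem IsDiscAut.comp {f g : ℂ → ℂ} (hf : IsDiscAut f) (hg : IsDiscAut g) :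
    IsDiscAut (f ∘ g) :=
  ⟨hf.1.comp hg.1 hg.2.mapsTo, hf.2.comp hg.2⟩

/-- The inverse of an injective analytic function on an open set is analytic. -/
theorem differentiableOn_invFunOn {f : ℂ → ℂ} {s t : Set ℂ} (hs : IsOpen s)
    (hd : DifferentiableOn ℂ f s) (hf : BijOn f s t) :
    DifferentiableOn ℂ (Function.invFunOn f s) t := by
  set g := Function.invFunOn f s
  have hgf : ∀ x ∈ s, g (f x) = x := fun x hx => hf.injOn.leftInvOn_invFunOn hx
  have han : AnalyticOnNhd ℂ f s := hd.analyticOnNhd hs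
  have hnc : ∀ x ∈ s, ¬ ∀ᶠ z in 𝓝 x, f z = f x := by
    intro x hx h
    obtain ⟨z, ⟨hz, hzs⟩, hne⟩ := ((h.and (hs.mem_nhds hx)).filter_mono
      nhdsWithin_le_nhds |>.and (self_mem_nhdsWithin : {x}ᶜ ∈ 𝓝[≠] x)).exists
    exact hne (hf.injOn hzs hx hz)
  -- Open mapping theorem: an injective analytic map is nowhere locally constant. This makes the
  -- inverse continuous.
  have hmap : ∀ x ∈ s, 𝓝 (f x) ≤ map f (𝓝 x) := fun x hx =>
    (han x hx).eventually_constant_or_nhds_le_map_nhds.resolve_left (hnc x hx)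
  have hcont : ∀ x ∈ s, Tendsto g (𝓝 (f x)) (𝓝 x) := by
    intro x hx
    refine Tendsto.mono_left ?_ (hmap x hx)
    rw [tendsto_map'_iff]
    refine tendsto_id.congr' ?_
    filter_upwards [hs.mem_nhds hx] with z hz using (hgf z hz).symm
  have hfg : ∀ x ∈ s, ∀ᶠ y in 𝓝 (f x), f (g y) = y := by
    intro x hx
    refine hmap x hx (mem_map.2 ?_)
    filter_upwards [hs.mem_nhds hx] with z hz
    simp [hgf z hz]
  have hgood : ∀ x ∈ s, deriv f x ≠ 0 → DifferentiableAt ℂ g (f x) := by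
    intro x hx h
    have h1 : HasDerivAt f (deriv f x) (g (f x)) := by
      rw [hgf x hx]; exact (hd.differentiableAt (hs.mem_nhds hx)).hasDerivAt
    refine (HasDerivAt.of_local_left_inverse ?_ h1 h (hfg x hx)).differentiableAt
    rw [ContinuousAt, hgf x hx]; exact hcont x hx
  intro y hy
  obtain ⟨x, hx, rfl⟩ := hf.surjOn hy
  refine (Complex.analyticAt_of_differentiable_on_punctured_nhds_of_continuousAt ?_
    ?_).differentiableAt.differentiableWithinAt
  -- Critical points are isolated, since otherwise `f` would be locally constant. The inverse is
  -- thus analytic on a punctured neighbourhood and continuous at the centre, a removable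
  -- singularity.
  · have hz : ∀ᶠ z in 𝓝[≠] x, deriv f z ≠ 0 := by
      refine (han x hx).deriv.eventually_eq_zero_or_eventually_ne_zero.resolve_left fun h => ?_
      obtain ⟨ε, hε, hb⟩ := Metric.eventually_nhds_iff_ball.1 (h.and (hs.mem_nhds hx))
      refine hnc x hx ?_
      filter_upwards [Metric.ball_mem_nhds x hε] with z hz
      refine (convex_ball x ε).is_const_of_fderivWithin_eq_zero (𝕜 := ℂ)
        (fun w hw => (hd.differentiableAt (hs.mem_nhds (hb w hw).2)).differentiableWithinAt)
        (fun w hw => ?_) hz (Metric.mem_ball_self hε)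
      rw [fderivWithin_of_isOpen Metric.isOpen_ball hw]
      ext
      simpa using (hb w hw).1
    have ht : Tendsto g (𝓝[≠] (f x)) (𝓝[≠] x) := by
      refine tendsto_nhdsWithin_iff.2 ⟨(hcont x hx).mono_left nhdsWithin_le_nhds, ?_⟩
      filter_upwards [self_mem_nhdsWithin, nhdsWithin_le_nhds (hfg x hx)] with y hy hy2 h
      exact hy (by rw [mem_singleton_iff.1 h] at hy2; exact hy2.symm)
    filter_upwards [ht.eventually hz, nhdsWithin_le_nhds (hfg x hx),
      nhdsWithin_le_nhds ((hcont x hx).eventually (hs.mem_nhds hx))] with y h1 h2 h3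
    rw [← h2]
    exact hgood _ h3 h1
  · rw [ContinuousAt, hgf x hx]; exact hcont x hx

/-- An automorphism of the disc fixing the origin is a rotation. -/
theorem IsDiscAut.exists_eq_mul {g : ℂ → ℂ} (hg : IsDiscAut g) (h0 : g 0 = 0) :
    ∃ η : ℂ, ‖η‖ = 1 ∧ ∀ z ∈ disc, g z = η * z := by
  have hk := differentiableOn_invFunOn Metric.isOpen_ball hg.1 hg.2
  set k := Function.invFunOn g disc
  have hkg : ∀ x ∈ disc, k (g x) = x := fun x hx => hg.2.injOn.leftInvOn_invFunOn hx
  have hkm : MapsTo k disc disc := hg.2.surjOn.mapsTo_invFunOn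
  have h0d : (0 : ℂ) ∈ disc := by simp
  have hk0 : k 0 = 0 := by simpa [h0] using hkg 0 h0d
  have hle : ∀ z ∈ disc, ‖g z‖ ≤ ‖z‖ := fun z hz =>
    Complex.norm_le_norm_of_mapsTo_ball hg.1
      (fun w hw => Metric.ball_subset_closedBall (hg.2.mapsTo hw)) h0 (mem_disc.1 hz)
  have hge : ∀ z ∈ disc, ‖z‖ ≤ ‖g z‖ := fun z hz => by
    simpa [hkg z hz] using Complex.norm_le_norm_of_mapsTo_ball hk
      (fun w hw => Metric.ball_subset_closedBall (hkm hw)) hk0 (mem_disc.1 (hg.2.mapsTo hz))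
  -- The Schwarz lemma for `g` and for its inverse gives `‖g z‖ = ‖z‖`. Equality at one nonzero
  -- point, here `1/2`, forces `g` to be linear.
  have hh : (1 / 2 : ℂ) ∈ disc := by rw [mem_disc]; norm_num
  obtain ⟨C, hC, hE⟩ := Complex.affine_of_mapsTo_ball_of_exists_norm_dslope_eq_div'
    (R₂ := 1) hg.1
    (fun w hw => by rw [h0]; exact Metric.ball_subset_closedBall (hg.2.mapsTo hw))
    ⟨1 / 2, hh, by
      rw [dslope_of_ne _ (by norm_num), slope_def_field, h0, sub_zero, sub_zero, norm_div,
        le_antisymm (hle _ hh) (hge _ hh)]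
      norm_num⟩
  refine ⟨C, by simpa using hC, fun z hz => ?_⟩
  simpa [h0, mul_comm] using hE hz

/-- If `c` is the zero of `φ`, then `φ ∘ σ_c` fixes the origin and is a rotation; `σ_c` is its own
inverse. -/
theorem IsDiscAut.exists_eq_mul_sigma {φ : ℂ → ℂ} (hφ : IsDiscAut φ) :
    ∃ η c : ℂ, ‖η‖ = 1 ∧ ‖c‖ < 1 ∧ ∀ z ∈ disc, φ z = η * sigma c z := by
  obtain ⟨c, hc, hc0⟩ := hφ.2.surjOn (show (0 : ℂ) ∈ disc by simp)
  have hc1 := mem_disc.1 hc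
  obtain ⟨η, hη, h⟩ := (hφ.comp (isDiscAut_sigma hc1)).exists_eq_mul
    (by simpa [sigma] using hc0)
  refine ⟨η, c, hη, hc1, fun z hz => ?_⟩
  have := h _ ((bijOn_sigma hc1).mapsTo hz)
  rwa [Function.comp, sigma_sigma hc1 (mem_disc.1 hz)] at this

/-! ### Area measure and conformal change of variables. -/

theorem det_toSpanSingleton_restrictScalars (c : ℂ) :
    ((ContinuousLinearMap.toSpanSingleton ℂ c).restrictScalars ℝ : ℂ →L[ℝ] ℂ).det
      = ‖c‖ ^ 2 := by
  simp [ContinuousLinearMap.det, LinearMap.det_restrictScalars,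
      Algebra.norm_complex_eq, Complex.normSq_eq_norm_sq]

theorem lintegral_area (F : ℂ → ℝ≥0∞) :
    ∫⁻ z, F z ∂area = (ENNReal.ofReal Real.pi)⁻¹ * ∫⁻ z in disc, F z := by
  rw [area, lintegral_smul_measure, smul_eq_mul]

theorem lintegral_area_comp {ψ ψ' : ℂ → ℂ} (hψ : BijOn ψ disc disc)
    (hd : ∀ z ∈ disc, HasDerivAt ψ (ψ' z) z) (F : ℂ → ℝ≥0∞) :
    ∫⁻ z, F z ∂area = ∫⁻ z, ENNReal.ofReal (‖ψ' z‖ ^ 2) * F (ψ z) ∂area := by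
  rw [lintegral_area, lintegral_area]
  congr 1
  conv_lhs => rw [← hψ.image_eq]
  rw [lintegral_image_eq_lintegral_abs_det_fderiv_mul volume measurableSet_ball
    (f' := fun z => (ContinuousLinearMap.toSpanSingleton ℂ (ψ' z)).restrictScalars ℝ)
    (fun z hz => ((hd z hz).hasFDerivAt.restrictScalars ℝ).hasFDerivWithinAt) hψ.injOn]
  simp only [det_toSpanSingleton_restrictScalars, abs_of_nonneg, sq_nonneg]

theorem ae_area_mem_disc : ∀ᵐ z ∂area, z ∈ disc :=
  Measure.ae_smul_measure (ae_restrict_mem measurableSet_ball) _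

instance : SFinite area := by unfold area; infer_instance

theorem area_disc : area disc = 1 := by
  rw [area, Measure.smul_apply, Measure.restrict_apply_self, smul_eq_mul, Complex.volume_ball]
  simp only [ENNReal.ofReal_one, one_pow, one_mul]
  rw [ENNReal.ofReal_eq_coe_nnreal Real.pi_nonneg]
  exact ENNReal.inv_mul_cancel (by simp [← NNReal.coe_eq_zero, Real.pi_ne_zero]) ENNReal.coe_ne_top

/-! ### Littlewood–Paley comparison of the two kernels. -/

/-- The squared modulus of `1 / ((1 - a z)(1 - b z))`. -/
noncomputable def quad (a b z : ℂ) : ℝ := ((‖1 - a * z‖ * ‖1 - b * z‖) ^ 2)⁻¹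

theorem quad_nonneg (a b z : ℂ) : 0 ≤ quad a b z := by unfold quad; positivity

theorem measurable_quad (a b : ℂ) : Measurable (quad a b) := by unfold quad; fun_prop

theorem measurable_sigma : Measurable (Function.uncurry sigma) := by
  unfold Function.uncurry sigma; fun_prop

theorem measurable_greenKernel : Measurable (Function.uncurry greenKernel) := by
  unfold Function.uncurry greenKernel
  refine Measurable.ite ?_ measurable_const ?_
  · exact measurableSet_eq_fun measurable_fst measurable_snd
  · fun_prop

theorem one_sub_mul_sigma {a w u : ℂ} (ha : ‖a‖ ≤ 1) (hw : ‖w‖ < 1) (hu : ‖u‖ < 1) :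
    1 - a * sigma w u =
      (1 - a * w) * (1 - (conj w - a) / (1 - a * w) * u) / (1 - conj w * u) := by
  have h1 := one_sub_mul_ne_zero (a := conj w) (by simpa using hw.le) hu
  have h2 := one_sub_mul_ne_zero ha hw
  rw [eq_div_iff h1, sigma, sub_mul, mul_assoc a, div_mul_cancel₀ _ h1, mul_sub (1 - a * w),
    ← mul_assoc (1 - a * w), mul_div_cancel₀ _ h2]
  ring

/-- The quotient is `σ_{\bar w}(a)`, so the closed disc of parameters is preserved. -/
theorem norm_conj_sub_div_le {a w : ℂ} (ha : ‖a‖ ≤ 1) (hw : ‖w‖ < 1) :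
    ‖(conj w - a) / (1 - a * w)‖ ≤ 1 := by
  have h2 := norm_one_sub_mul_pos ha hw
  rw [norm_div, div_le_one h2]
  have := normSq_one_sub_conj_mul_sub (conj a) w
  rw [← Complex.norm_conj (conj a - w)] at this
  simp only [Complex.conj_conj, map_sub, RCLike.norm_conj] at this
  rw [norm_sub_rev]
  refine abs_le_of_sq_le_sq' ?_ h2.le |>.2
  have h3 : 0 ≤ 1 - ‖a‖ ^ 2 := by nlinarith [norm_nonneg a]
  have h4 : 0 ≤ 1 - ‖w‖ ^ 2 := by nlinarith [norm_nonneg w]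
  nlinarith [mul_nonneg h3 h4]

/-- Each of the two linear factors pulls back to a linear factor over `1 - \bar w u`. The resulting
`|1 - \bar w u|⁴` cancels the Jacobian exactly, which is why the weight carries two factors, even
when a single one is of interest. -/
theorem quad_sigma {a b w u : ℂ} (ha : ‖a‖ ≤ 1) (hb : ‖b‖ ≤ 1) (hw : ‖w‖ < 1) (hu : ‖u‖ < 1) :
    ‖-(1 - conj w * w) / (1 - conj w * u) ^ 2‖ ^ 2 * quad a b (sigma w u) =
      ‖1 - conj w * w‖ ^ 2 * quad a b w *
        quad ((conj w - a) / (1 - a * w)) ((conj w - b) / (1 - b * w)) u := by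
  have h1 := norm_one_sub_mul_pos (a := conj w) (by simpa using hw.le) hu
  have h2 := norm_one_sub_mul_pos ha hw
  have h3 := norm_one_sub_mul_pos hb hw
  have h4 := norm_one_sub_mul_pos (norm_conj_sub_div_le ha hw) hu
  have h5 := norm_one_sub_mul_pos (norm_conj_sub_div_le hb hw) hu
  simp only [quad, one_sub_mul_sigma ha hw hu, one_sub_mul_sigma hb hw hu, norm_div, norm_mul,
    norm_neg, norm_pow]
  generalize ‖1 - (conj w - a) / (1 - a * w) * u‖ = A at *
  generalize ‖1 - (conj w - b) / (1 - b * w) * u‖ = B at *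
  generalize ‖1 - conj w * u‖ = D at *
  generalize ‖1 - a * w‖ = E at *
  generalize ‖1 - b * w‖ = F at *
  field_simp

theorem quad_le {a b u : ℂ} (ha : ‖a‖ ≤ 1) (hb : ‖b‖ ≤ 1) (hu : ‖u‖ < 1 / 2) :
    quad a b u ≤ 16 := by
  have key : ∀ c : ℂ, ‖c‖ ≤ 1 → 1 / 2 ≤ ‖1 - c * u‖ := fun c hc => by
    have := norm_sub_norm_le (1 : ℂ) (c * u)
    rw [norm_one, norm_mul] at this
    nlinarith [norm_nonneg c, norm_nonneg u]
  have h : (1 / 4 : ℝ) ≤ ‖1 - a * u‖ * ‖1 - b * u‖ := by nlinarith [key a ha, key b hb]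
  rw [quad, inv_le_comm₀ (by positivity) (by norm_num)]
  nlinarith

theorem le_quad {a b u : ℂ} (ha : ‖a‖ ≤ 1) (hb : ‖b‖ ≤ 1) (hu : ‖u‖ < 1) :
    1 / 16 ≤ quad a b u := by
  have key : ∀ c : ℂ, ‖c‖ ≤ 1 → ‖1 - c * u‖ ≤ 2 := fun c hc => by
    have := norm_sub_le (1 : ℂ) (c * u)
    rw [norm_one, norm_mul] at this
    nlinarith [norm_nonneg c, norm_nonneg u]
  have h0 := norm_one_sub_mul_pos ha hu
  have h1 := norm_one_sub_mul_pos hb hu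
  have h : ‖1 - a * u‖ * ‖1 - b * u‖ ≤ 4 := by nlinarith [key a ha, key b hb]
  rw [quad, one_div, inv_le_inv₀ (by norm_num) (by positivity)]
  nlinarith [mul_pos h0 h1]

/-- The logarithmic singularity is integrable over a small disc. -/
theorem lintegral_log_lt_top :
    ∫⁻ u in Metric.ball (0 : ℂ) (1 / 2), ENNReal.ofReal (Real.log ((‖u‖ ^ 2)⁻¹)) ∂area < ⊤ := by
  -- The bound `log x ≤ x` gives `log(r⁻²) ≤ 2/r`, and the polar Jacobian `r` cancels this
  -- singularity.
  have hle : ∀ u : ℂ, (Metric.ball (0 : ℂ) (1 / 2)).indicator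
      (fun u => ENNReal.ofReal (Real.log ((‖u‖ ^ 2)⁻¹))) u ≤
      (Metric.ball (0 : ℂ) 1).indicator (fun u => ENNReal.ofReal (2 * ‖u‖⁻¹)) u := by
    intro u
    refine (indicator_le_indicator_of_subset (Metric.ball_subset_ball (by norm_num))
      (fun _ => zero_le) u).trans (indicator_le_indicator ?_)
    refine ENNReal.ofReal_le_ofReal ?_
    rw [← inv_pow, Real.log_pow]
    have := Real.log_le_self (inv_nonneg.2 (norm_nonneg u))
    push_cast; linarith
  have h1 : ∫⁻ u in Metric.ball (0 : ℂ) (1 / 2), ENNReal.ofReal (Real.log ((‖u‖ ^ 2)⁻¹)) ≤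
      ∫⁻ p in Ioo (0 : ℝ) 1 ×ˢ Ioo (-Real.pi) Real.pi, 2 := by
    rw [← lintegral_indicator measurableSet_ball]
    refine (lintegral_mono hle).trans ?_
    rw [← Complex.lintegral_comp_polarCoord_symm,
      ← lintegral_indicator (measurableSet_Ioo.prod measurableSet_Ioo),
      ← lintegral_indicator polarCoord.open_target.measurableSet]
    refine lintegral_mono fun p => ?_
    by_cases hp : p ∈ polarCoord.target
    · rw [indicator_of_mem hp]
      have hp' := hp
      rw [polarCoord_target, mem_prod, mem_Ioi] at hp'
      have hn : ‖Complex.polarCoord.symm p‖ = p.1 := by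
        rw [Complex.norm_polarCoord_symm, abs_of_pos hp'.1]
      by_cases h1 : p.1 < 1
      · rw [indicator_of_mem (by rw [mem_ball_zero_iff, hn]; exact h1),
          indicator_of_mem (show p ∈ Ioo (0 : ℝ) 1 ×ˢ Ioo (-Real.pi) Real.pi from
            ⟨⟨hp'.1, h1⟩, hp'.2⟩), hn, smul_eq_mul, ← ENNReal.ofReal_mul hp'.1.le]
        rw [mul_left_comm, mul_inv_cancel₀ hp'.1.ne']
        simp
      · rw [indicator_of_notMem (by rw [mem_ball_zero_iff, hn]; exact h1)]
        simp
    · rw [indicator_of_notMem hp]; exact zero_le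
  rw [area, Measure.restrict_smul, lintegral_smul_measure, Measure.restrict_restrict
    measurableSet_ball, inter_eq_left.2 (Metric.ball_subset_ball (by norm_num)), smul_eq_mul]
  refine ENNReal.mul_lt_top (ENNReal.inv_lt_top.2 (by simp [Real.pi_pos])) (h1.trans_lt ?_)
  rw [lintegral_const, Measure.restrict_apply_univ, Measure.volume_eq_prod, Measure.prod_prod]
  simp only [Real.volume_Ioo]
  exact ENNReal.mul_lt_top (by simp) (ENNReal.mul_lt_top (by simp) (by simp))

theorem area_ball_half_pos : area (Metric.ball (0 : ℂ) (1 / 2)) ≠ 0 := by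
  rw [area, Measure.smul_apply, Measure.restrict_apply measurableSet_ball,
    inter_eq_left.2 (Metric.ball_subset_ball (by norm_num)), smul_eq_mul]
  refine mul_ne_zero (ENNReal.inv_ne_zero.2 (by simp)) ?_
  exact (Metric.measure_ball_pos volume _ (by norm_num)).ne'

theorem area_ne_top (s : Set ℂ) : area s ≠ ⊤ := by
  have : area univ = 1 := by
    rw [← area_disc, area, Measure.smul_apply, Measure.smul_apply, Measure.restrict_apply_univ,
      Measure.restrict_apply_self]
  exact ((measure_mono (subset_univ s)).trans_lt (this.trans_lt ENNReal.one_lt_top)).ne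

/-- A Littlewood–Paley comparison at the origin. -/
theorem exists_lintegral_quad_log_le : ∃ C : ℝ≥0∞, C ≠ ⊤ ∧ ∀ a b : ℂ, ‖a‖ ≤ 1 → ‖b‖ ≤ 1 →
    ∫⁻ u, ENNReal.ofReal (quad a b u) * ENNReal.ofReal (Real.log ((‖u‖ ^ 2)⁻¹)) ∂area ≤
      C * ∫⁻ u, ENNReal.ofReal (quad a b u) * ENNReal.ofReal (1 - ‖u‖ ^ 2) ∂area := by
  set B := Metric.ball (0 : ℂ) (1 / 2)
  set I := ∫⁻ u in B, ENNReal.ofReal (Real.log ((‖u‖ ^ 2)⁻¹)) ∂area with hI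
  have hIt : I ≠ ⊤ := lintegral_log_lt_top.ne
  have hA0 : area B ≠ 0 := area_ball_half_pos
  have hAt : area B ≠ ⊤ := area_ne_top B
  have h32 : ENNReal.ofReal (1 / 32) ≠ 0 := by simp
  have h32' : ENNReal.ofReal (1 / 32) ≠ ⊤ := by simp
  -- On `B` the weight is at most 16, while `J` is at least `area B / 32` because there `quad ≥
  -- 1/16` and `1 - |u|² ≥ 1/2`. Off `B`, with `x = |u|² ≥ 1/4`, one has `log(1/x) ≤ (1 - x)/x ≤ 4(1
  -- - x)`.
  refine ⟨16 * I * (ENNReal.ofReal (1 / 32) * area B)⁻¹ + 4, ?_, fun a b ha hb => ?_⟩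
  · refine ENNReal.add_ne_top.2 ⟨ENNReal.mul_ne_top (ENNReal.mul_ne_top (by simp) hIt) ?_, by simp⟩
    exact ENNReal.inv_ne_top.2 (mul_ne_zero h32 hA0)
  set J := ∫⁻ u, ENNReal.ofReal (quad a b u) * ENNReal.ofReal (1 - ‖u‖ ^ 2) ∂area with hJ
  have hlow : ENNReal.ofReal (1 / 32) * area B ≤ J := by
    rw [← setLIntegral_const]
    refine le_trans ?_ (setLIntegral_le_lintegral B _)
    refine setLIntegral_mono' measurableSet_ball fun u hu => ?_
    rw [mem_ball_zero_iff] at hu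
    rw [← ENNReal.ofReal_mul (quad_nonneg _ _ _)]
    refine ENNReal.ofReal_le_ofReal ?_
    have h1 := le_quad ha hb (hu.trans (by norm_num))
    have h2 : 1 / 2 ≤ 1 - ‖u‖ ^ 2 := by nlinarith [norm_nonneg u]
    nlinarith
  rw [← lintegral_add_compl _ (measurableSet_ball : MeasurableSet B), add_mul]
  refine add_le_add ?_ ?_
  · calc _ ≤ ∫⁻ u in B, 16 * ENNReal.ofReal (Real.log ((‖u‖ ^ 2)⁻¹)) ∂area := by
          refine setLIntegral_mono' measurableSet_ball fun u hu => ?_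
          gcongr
          rw [mem_ball_zero_iff] at hu
          exact ENNReal.ofReal_le_of_le_toReal (by simpa using quad_le ha hb hu)
      _ = 16 * I := lintegral_const_mul' _ _ (by simp)
      _ = 16 * I * ((ENNReal.ofReal (1 / 32) * area B)⁻¹ * (ENNReal.ofReal (1 / 32) * area B)) := by
          rw [ENNReal.inv_mul_cancel (mul_ne_zero h32 hA0) (ENNReal.mul_ne_top h32' hAt), mul_one]
      _ ≤ _ := by rw [← mul_assoc]; gcongr
  · rw [hJ, ← lintegral_const_mul' _ _ (by simp)]
    refine le_trans ?_ (setLIntegral_le_lintegral Bᶜ _)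
    refine lintegral_mono_ae ?_
    rw [ae_restrict_iff' measurableSet_ball.compl]
    filter_upwards [ae_area_mem_disc] with u hu hB
    rw [mem_disc] at hu
    rw [mem_compl_iff, mem_ball_zero_iff, not_lt] at hB
    rw [mul_left_comm]
    gcongr
    rw [show (4 : ℝ≥0∞) = ENNReal.ofReal 4 by simp, ← ENNReal.ofReal_mul (by norm_num)]
    refine ENNReal.ofReal_le_ofReal ?_
    have h4 : (1 / 4 : ℝ) ≤ ‖u‖ ^ 2 := by nlinarith
    refine (Real.log_le_sub_one_of_pos (by positivity)).trans ?_
    have : (‖u‖ ^ 2)⁻¹ ≤ 4 := by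
      rw [inv_le_comm₀ (by positivity) (by norm_num)]; linarith
    have h5 : (‖u‖ ^ 2)⁻¹ * ‖u‖ ^ 2 = 1 := inv_mul_cancel₀ (by positivity)
    have h6 : ‖u‖ ^ 2 ≤ 1 := by nlinarith
    nlinarith [mul_nonneg (sub_nonneg.2 this) (sub_nonneg.2 h6)]

theorem ae_area_ne (w : ℂ) : ∀ᵐ z ∂area, z ≠ w :=
  Measure.ae_smul_measure (ae_restrict_of_ae (Measure.ae_ne volume w)) _

theorem greenKernel_of_ne {z w : ℂ} (h : z ≠ w) :
    greenKernel z w = ENNReal.ofReal (Real.log ((‖sigma w z‖ ^ 2)⁻¹)) := by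
  rw [greenKernel, if_neg h, sigma, ← inv_pow, ← norm_inv, inv_div, norm_div, norm_div,
    norm_sub_rev z w]

theorem ofReal_one_sub_le_greenKernel {z w : ℂ} (hz : ‖z‖ < 1) (hw : ‖w‖ < 1) :
    ENNReal.ofReal (1 - ‖sigma z w‖ ^ 2) ≤ greenKernel z w := by
  by_cases h : z = w
  · simp [greenKernel, h]
  have h0 : sigma w z ≠ 0 := div_ne_zero (sub_ne_zero.2 (Ne.symm h))
    (one_sub_mul_ne_zero (by simpa using hw.le) hz)
  rw [greenKernel_of_ne h, norm_sigma_comm]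
  refine ENNReal.ofReal_le_ofReal ?_
  rw [Real.log_inv]
  have := Real.log_le_sub_one_of_pos (x := ‖sigma w z‖ ^ 2) (by positivity)
  linarith

theorem V_le_U (μ : Measure ℂ) {z : ℂ} (hz : ‖z‖ < 1) : V μ z ≤ U μ z :=
  setLIntegral_mono' measurableSet_ball fun _ hw =>
    ofReal_one_sub_le_greenKernel hz (mem_disc.1 hw)

/-- Conformally invariant Littlewood–Paley comparison of the two kernels. -/
theorem exists_lintegral_quad_greenKernel_le : ∃ C : ℝ≥0∞, C ≠ ⊤ ∧ ∀ a b w : ℂ,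
    ‖a‖ ≤ 1 → ‖b‖ ≤ 1 → ‖w‖ < 1 →
    ∫⁻ z, ENNReal.ofReal (quad a b z) * greenKernel z w ∂area ≤
      C * ∫⁻ z, ENNReal.ofReal (quad a b z) * ENNReal.ofReal (1 - ‖sigma z w‖ ^ 2) ∂area := by
  obtain ⟨C, hC, h⟩ := exists_lintegral_quad_log_le
  refine ⟨C, hC, fun a b w ha hb hw => ?_⟩
  have hd : ∀ z ∈ disc, HasDerivAt (sigma w) _ z := fun z hz =>
    hasDerivAt_sigma hw (mem_disc.1 hz)
  rw [lintegral_area_comp (bijOn_sigma hw) hd fun z => _ * greenKernel z w,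
    lintegral_area_comp (bijOn_sigma hw) hd fun z => _ * ENNReal.ofReal (1 - ‖sigma z w‖ ^ 2)]
  set κ := ENNReal.ofReal (‖1 - conj w * w‖ ^ 2 * quad a b w)
  set a' := (conj w - a) / (1 - a * w)
  set b' := (conj w - b) / (1 - b * w)
  have hq : ∀ u ∈ disc, ∀ X : ℝ≥0∞,
      ENNReal.ofReal (‖-(1 - conj w * w) / (1 - conj w * u) ^ 2‖ ^ 2) *
        (ENNReal.ofReal (quad a b (sigma w u)) * X) = κ * (ENNReal.ofReal (quad a' b' u) * X) := by
    intro u hu X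
    rw [← mul_assoc, ← mul_assoc, ← ENNReal.ofReal_mul (by positivity),
      quad_sigma ha hb hw (mem_disc.1 hu),
      ENNReal.ofReal_mul (mul_nonneg (by positivity) (quad_nonneg _ _ _))]
  -- The point `u = 0` must be discarded: there `greenKernel` is `⊤`, whereas the real logarithm
  -- takes its default value 0.
  have h1 : ∀ᵐ u ∂area, ENNReal.ofReal (‖-(1 - conj w * w) / (1 - conj w * u) ^ 2‖ ^ 2) *
        (ENNReal.ofReal (quad a b (sigma w u)) * greenKernel (sigma w u) w) =
        κ * (ENNReal.ofReal (quad a' b' u) * ENNReal.ofReal (Real.log ((‖u‖ ^ 2)⁻¹))) := by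
    filter_upwards [ae_area_mem_disc, ae_area_ne 0] with u hu h0
    rw [hq u hu, greenKernel_of_ne, sigma_sigma hw (mem_disc.1 hu)]
    intro h
    have := sigma_sigma hw (mem_disc.1 hu)
    rw [h, sigma, sub_self, zero_div] at this
    exact h0 this.symm
  have h2 : ∀ᵐ u ∂area, ENNReal.ofReal (‖-(1 - conj w * w) / (1 - conj w * u) ^ 2‖ ^ 2) *
        (ENNReal.ofReal (quad a b (sigma w u)) * ENNReal.ofReal (1 - ‖sigma (sigma w u) w‖ ^ 2)) =
        κ * (ENNReal.ofReal (quad a' b' u) * ENNReal.ofReal (1 - ‖u‖ ^ 2)) := by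
    filter_upwards [ae_area_mem_disc] with u hu
    rw [hq u hu, norm_sigma_comm, sigma_sigma hw (mem_disc.1 hu)]
  rw [lintegral_congr_ae h1, lintegral_congr_ae h2,
    lintegral_const_mul' _ _ ENNReal.ofReal_ne_top, lintegral_const_mul' _ _ ENNReal.ofReal_ne_top,
    mul_left_comm C]
  gcongr
  exact h a' b' (norm_conj_sub_div_le ha hw) (norm_conj_sub_div_le hb hw)

/-! ### From kernels to the potentials, and s-finiteness of the measure. -/

theorem measurable_V (μ : Measure ℂ) [SFinite (μ.restrict disc)] : Measurable (V μ) := by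
  unfold V
  refine Measurable.lintegral_prod_right' (f := fun p : ℂ × ℂ =>
    ENNReal.ofReal (1 - ‖sigma p.1 p.2‖ ^ 2)) ?_
  have := measurable_sigma
  unfold Function.uncurry at this
  fun_prop

theorem exists_lintegral_quad_U_le : ∃ C : ℝ≥0∞, C ≠ ⊤ ∧ ∀ (μ : Measure ℂ)
    [SFinite (μ.restrict disc)] (a b : ℂ), ‖a‖ ≤ 1 → ‖b‖ ≤ 1 →
    ∫⁻ z, ENNReal.ofReal (quad a b z) * U μ z ∂area ≤
      C * ∫⁻ z, ENNReal.ofReal (quad a b z) * V μ z ∂area := by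
  obtain ⟨C, hC, h⟩ := exists_lintegral_quad_greenKernel_le
  refine ⟨C, hC, fun μ _ a b ha hb => ?_⟩
  have hq : Measurable fun p : ℂ × ℂ => ENNReal.ofReal (quad a b p.1) :=
    ((measurable_quad a b).comp measurable_fst).ennreal_ofReal
  have hs := measurable_sigma
  have hg := measurable_greenKernel
  unfold Function.uncurry at hs hg
  unfold U V
  simp only [← lintegral_const_mul' _ _ ENNReal.ofReal_ne_top]
  have hs' : Measurable fun p : ℂ × ℂ => ENNReal.ofReal (1 - ‖sigma p.1 p.2‖ ^ 2) := by fun_prop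
  rw [lintegral_lintegral_swap (f := fun z w => ENNReal.ofReal (quad a b z) * greenKernel z w) (hq.mul hg).aemeasurable,
    lintegral_lintegral_swap (f := fun z w => ENNReal.ofReal (quad a b z) * ENNReal.ofReal (1 - ‖sigma z w‖ ^ 2))
      (hq.mul hs').aemeasurable, ← lintegral_const_mul' _ _ hC]
  refine setLIntegral_mono' measurableSet_ball fun w hw => ?_
  exact h a b w ha hb (mem_disc.1 hw)

/-- Tonelli's theorem needs s-finiteness, and `μ` is arbitrary. The integrand of `V μ z` is positive
on the disc, so it is a density turning `μ` into a finite measure, and dividing by it recovers `μ`.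
-/
theorem sFinite_restrict_of_V_ne_top {μ : Measure ℂ} {z : ℂ} (hz : ‖z‖ < 1) (h : V μ z ≠ ⊤) :
    SFinite (μ.restrict disc) := by
  set f : ℂ → ℝ≥0∞ := fun w => ENNReal.ofReal (1 - ‖sigma z w‖ ^ 2) with hf
  have hs := measurable_sigma
  unfold Function.uncurry at hs
  have hm : Measurable f := by
    have : Measurable fun w => sigma z w := hs.comp (measurable_const.prodMk measurable_id)
    fun_prop
  have hfin : IsFiniteMeasure ((μ.restrict disc).withDensity f) :=
    isFiniteMeasure_withDensity h
  have h0 : ∀ᵐ w ∂μ.restrict disc, f w ≠ 0 := by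
    filter_upwards [ae_restrict_mem measurableSet_ball] with w hw
    have := norm_sigma_lt_one hz (mem_disc.1 hw)
    simp only [hf, ne_eq, ENNReal.ofReal_eq_zero, not_le]
    nlinarith [norm_nonneg (sigma z w)]
  rw [← withDensity_inv_same hm h0 (by simp [hf])]
  infer_instance

/-! ### Membership in `M(D_μ)` through the size of the derivative. -/

theorem memMD_iff {μ : Measure ℂ} {f : ℂ → ℂ} : MemMD μ f ↔ DifferentiableOn ℂ f disc ∧
    ∃ C : ℝ≥0∞, C ≠ ⊤ ∧ ∀ φ, IsDiscAut φ → ∫⁻ w, ‖deriv f w‖ₑ ^ 2 * U μ (φ w) ∂area ≤ C := by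
  rw [MemMD, normMD]
  refine and_congr_right fun _ => ⟨fun h => ?_, fun ⟨C, hC, h⟩ => ?_⟩
  · set S := ⨆ (φ : ℂ → ℂ) (_ : IsDiscAut φ),
      (∫⁻ w, ‖deriv f w‖ₑ ^ 2 * U μ (φ w) ∂area) ^ (1 / 2 : ℝ) with hS
    refine ⟨S ^ (2 : ℝ), ENNReal.rpow_ne_top_of_nonneg (by norm_num)
      (le_add_self.trans_lt h).ne, fun φ hφ => ?_⟩
    have h1 : (∫⁻ w, ‖deriv f w‖ₑ ^ 2 * U μ (φ w) ∂area) ^ (1 / 2 : ℝ) ≤ S :=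
      le_iSup₂_of_le φ hφ le_rfl
    have h2 := ENNReal.rpow_le_rpow h1 (show (0 : ℝ) ≤ 2 by norm_num)
    rwa [← ENNReal.rpow_mul, show (1 / 2 : ℝ) * 2 = 1 by norm_num, ENNReal.rpow_one] at h2
  · refine ENNReal.add_lt_top.2 ⟨enorm_lt_top, lt_of_le_of_lt (iSup₂_le fun φ hφ =>
      ENNReal.rpow_le_rpow (h φ hφ) (by norm_num)) ?_⟩
    exact ENNReal.rpow_lt_top_of_nonneg (by norm_num) hC

theorem norm_one_sub_pos_of_mem_disc {w : ℂ} (hw : w ∈ disc) : 0 < ‖1 - w‖ := by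
  simpa using norm_one_sub_mul_pos (a := 1) (by simp) (mem_disc.1 hw)

theorem hasDerivAt_log_one_sub {w : ℂ} (hw : w ∈ disc) :
    HasDerivAt (fun z : ℂ => Complex.log (1 - z)) (-(1 - w)⁻¹) w := by
  have h : 1 - w ∈ Complex.slitPlane := by
    refine Or.inl ?_
    have := (Complex.re_le_norm w).trans_lt (mem_disc.1 hw)
    simpa using this
  refine (((hasDerivAt_id w).const_sub 1).clog h).congr_deriv ?_
  simp [div_eq_mul_inv]

theorem MemMD.mono {μ : Measure ℂ} {f g : ℂ → ℂ} (hf : MemMD μ f)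
    (hg : DifferentiableOn ℂ g disc) {K : ℝ} (h : ∀ w ∈ disc, ‖deriv g w‖ ≤ K * ‖deriv f w‖) :
    MemMD μ g := by
  obtain ⟨-, C, hC, hb⟩ := memMD_iff.1 hf
  have hK : ENNReal.ofReal K ^ 2 ≠ ⊤ := by simp
  refine memMD_iff.2 ⟨hg, ENNReal.ofReal K ^ 2 * C, ENNReal.mul_ne_top hK hC,
    fun φ hφ => ?_⟩
  refine le_trans ?_ (mul_le_mul_right (hb φ hφ) _)
  rw [← lintegral_const_mul' _ _ hK]
  refine lintegral_mono_ae ?_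
  filter_upwards [ae_area_mem_disc] with w hw
  rw [← mul_assoc, ← mul_pow]
  gcongr
  rw [← ofReal_norm, ← ofReal_norm, ← ENNReal.ofReal_mul' (norm_nonneg _)]
  exact ENNReal.ofReal_le_ofReal (h w hw)

theorem memMD_log_iff {μ : Measure ℂ} : MemMD μ (fun z : ℂ => Complex.log (1 - z)) ↔
    ∃ C : ℝ≥0∞, C ≠ ⊤ ∧ ∀ φ, IsDiscAut φ → ∫⁻ w, U μ (φ w) / ‖1 - w‖ₑ ^ 2 ∂area ≤ C := by
  have hd : DifferentiableOn ℂ (fun z : ℂ => Complex.log (1 - z)) disc := fun z hz =>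
    (hasDerivAt_log_one_sub hz).differentiableAt.differentiableWithinAt
  rw [memMD_iff, and_iff_right hd]
  have : ∀ φ : ℂ → ℂ,
      ∫⁻ w, ‖deriv (fun z : ℂ => Complex.log (1 - z)) w‖ₑ ^ 2 * U μ (φ w) ∂area =
      ∫⁻ w, U μ (φ w) / ‖1 - w‖ₑ ^ 2 ∂area := by
    intro φ
    refine lintegral_congr_ae ?_
    filter_upwards [ae_area_mem_disc] with w hw
    rw [(hasDerivAt_log_one_sub hw).deriv, enorm_neg, enorm_inv
      (norm_pos_iff.1 (norm_one_sub_pos_of_mem_disc hw)), mul_comm, ← ENNReal.inv_pow, div_eq_mul_inv]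
  simp only [this]

/-! ### Transferring the automorphism to the weight. -/

theorem div_enorm_sq {x : ℂ} (hx : 0 < ‖x‖) (X : ℝ≥0∞) :
    X / ‖x‖ₑ ^ 2 = ENNReal.ofReal ((‖x‖ ^ 2)⁻¹) * X := by
  rw [div_eq_mul_inv, mul_comm, ENNReal.ofReal_inv_of_pos (by positivity),
    ENNReal.ofReal_pow (norm_nonneg _), ofReal_norm]

/-- The boundary point `λ` with `1 - σ_c(η̄ z) = (1 - c)(1 - λ z) / (1 - \bar c \bar η z)`. -/
theorem exists_boundary_point {η c : ℂ} (hη : ‖η‖ = 1) (hc : ‖c‖ < 1) :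
    ∃ l : ℂ, ‖l‖ = 1 ∧ ∀ z : ℂ, ‖z‖ < 1 →
      ‖conj η * (-(1 - conj c * c) / (1 - conj c * (conj η * z)) ^ 2)‖ ^ 2 *
        (‖1 - sigma c (conj η * z)‖ ^ 2)⁻¹ =
      ‖l - conj c * conj η‖ ^ 2 * quad (conj c * conj η) l z := by
  have hc1 : 1 - c ≠ 0 := by simpa using one_sub_mul_ne_zero (a := 1) (by simp) hc
  have hc1' : ‖1 - c‖ ≠ 0 := norm_ne_zero_iff.2 hc1
  -- The numerator of `1 - σ_c(η̄z)` is `(1 - c) + η̄(1 - c̄)z`; factoring out `1 - c` produces `l`.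
  refine ⟨-conj η * (1 - conj c) / (1 - c), ?_, fun z hz => ?_⟩
  · have : ‖1 - conj c‖ = ‖1 - c‖ := by rw [← Complex.norm_conj (1 - c)]; simp
    rw [norm_div, norm_mul, norm_neg, Complex.norm_conj, hη, this, one_mul, div_self hc1']
  · set l := -conj η * (1 - conj c) / (1 - c) with hl
    have hα : ‖conj c * conj η‖ ≤ 1 := by simp [hη, hc.le]
    have h1 : 1 - conj c * (conj η * z) ≠ 0 := by
      rw [← mul_assoc]; exact one_sub_mul_ne_zero hα hz
    have h2 : 1 - sigma c (conj η * z) =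
        (1 - c) * (1 - l * z) / (1 - conj c * (conj η * z)) := by
      rw [eq_div_iff h1, sigma, sub_mul, div_mul_cancel₀ _ h1, hl]
      field_simp
      ring
    -- This accounts for the factor `1 - |c|²` of the Jacobian together with the `1 - c` just
    -- extracted.
    have h3 : l - conj c * conj η = -conj η * (1 - conj c * c) / (1 - c) := by
      rw [hl]; field_simp; ring
    have h4 : ‖1 - conj c * (conj η * z)‖ ≠ 0 := norm_ne_zero_iff.2 h1
    rw [h2, h3, quad, mul_assoc (conj c)]
    simp only [norm_mul, norm_div, norm_neg, norm_pow, Complex.norm_conj, hη, one_mul]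
    generalize ‖1 - conj c * (conj η * z)‖ = D at *
    generalize ‖1 - c‖ = E at *
    generalize ‖1 - l * z‖ = F at *
    by_cases hF : F = 0
    · simp [hF]
    field_simp

/-- Partial fractions, followed by `|x - y|² ≤ 2(|x|² + |y|²)`. -/
theorem normSq_sub_mul_quad_le {a b z : ℂ} (ha : ‖a‖ ≤ 1) (hb : ‖b‖ ≤ 1) (hz : ‖z‖ < 1) :
    ‖b - a‖ ^ 2 * quad a b z ≤ 2 * ((‖1 - b * z‖ ^ 2)⁻¹ + (‖1 - a * z‖ ^ 2)⁻¹) := by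
  have h1 := one_sub_mul_ne_zero ha hz
  have h2 := one_sub_mul_ne_zero hb hz
  have h3 : (b - a) / ((1 - a * z) * (1 - b * z)) = b / (1 - b * z) - a / (1 - a * z) := by
    rw [div_sub_div _ _ h2 h1]; congr 1 <;> ring
  have h4 : ‖b - a‖ ^ 2 * quad a b z = ‖b / (1 - b * z) - a / (1 - a * z)‖ ^ 2 := by
    rw [← h3, quad, norm_div, norm_mul, div_pow, div_eq_mul_inv]
  have key : ∀ c : ℂ, ‖c‖ ≤ 1 → ‖c / (1 - c * z)‖ ^ 2 ≤ (‖1 - c * z‖ ^ 2)⁻¹ := fun c hc => by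
    rw [norm_div, div_pow, div_eq_mul_inv]
    exact mul_le_of_le_one_left (by positivity) (pow_le_one₀ (norm_nonneg _) hc)
  have h5 := norm_sub_le (b / (1 - b * z)) (a / (1 - a * z))
  have h6 : ‖b / (1 - b * z) - a / (1 - a * z)‖ ^ 2 ≤
      (‖b / (1 - b * z)‖ + ‖a / (1 - a * z)‖) ^ 2 := by gcongr
  rw [h4]
  nlinarith [key a ha, key b hb, sq_nonneg (‖b / (1 - b * z)‖ - ‖a / (1 - a * z)‖)]

/-- With `φ = ησ_c`, the substitution `w = σ_c(η̄z)` inverts `φ` and leaves `U μ z` against the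
weight with parameters `a = c̄η̄` and `l`. The constant depends on neither `μ` nor `φ`. -/
theorem lintegral_U_comp_le : ∃ C : ℝ≥0∞, C ≠ ⊤ ∧ ∀ (μ : Measure ℂ)
    [SFinite (μ.restrict disc)] (φ : ℂ → ℂ), IsDiscAut φ →
    ∃ l ∈ circle, ∃ a ∈ disc, ∫⁻ w, U μ (φ w) / ‖1 - w‖ₑ ^ 2 ∂area ≤
      C * (∫⁻ z, V μ z / ‖1 - l * z‖ₑ ^ 2 ∂area + ∫⁻ z, V μ z / ‖1 - a * z‖ₑ ^ 2 ∂area) := by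
  obtain ⟨C, hC, h⟩ := exists_lintegral_quad_U_le
  refine ⟨C * 2, ENNReal.mul_ne_top hC (by simp), fun μ _ φ hφ => ?_⟩
  obtain ⟨η, c, hη, hc, hφe⟩ := hφ.exists_eq_mul_sigma
  obtain ⟨l, hl, hid⟩ := exists_boundary_point hη hc
  have hη' : ‖conj η‖ = 1 := by simpa using hη
  have hηη : η * conj η = 1 := by
    rw [Complex.mul_conj, Complex.normSq_eq_norm_sq, hη]; simp
  set a := conj c * conj η with ha
  have hα : ‖a‖ < 1 := by simpa [ha, hη] using hc
  refine ⟨l, by simpa [circle] using hl, a, mem_disc.2 hα, ?_⟩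
  have hmem : ∀ z ∈ disc, conj η * z ∈ disc := fun z hz =>
    (isDiscAut_const_mul hη').2.mapsTo hz
  have hψ : BijOn (fun z => sigma c (conj η * z)) disc disc :=
    ((isDiscAut_sigma hc).comp (isDiscAut_const_mul hη')).2
  have hψd : ∀ z ∈ disc, HasDerivAt (fun z => sigma c (conj η * z))
      (conj η * (-(1 - conj c * c) / (1 - conj c * (conj η * z)) ^ 2)) z := fun z hz => by
    have h1 : HasDerivAt (fun z => conj η * z) (conj η) z := by
      simpa using (hasDerivAt_id z).const_mul (conj η)
    rw [mul_comm]
    exact (hasDerivAt_sigma hc (mem_disc.1 (hmem z hz))).comp z h1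
  rw [lintegral_area_comp hψ hψd]
  have h1 : ∀ᵐ z ∂area,
      ENNReal.ofReal (‖conj η * (-(1 - conj c * c) / (1 - conj c * (conj η * z)) ^ 2)‖ ^ 2) *
        (U μ (φ (sigma c (conj η * z))) / ‖1 - sigma c (conj η * z)‖ₑ ^ 2) =
      ENNReal.ofReal (‖l - a‖ ^ 2) * (ENNReal.ofReal (quad a l z) * U μ z) := by
    filter_upwards [ae_area_mem_disc] with z hz
    rw [div_enorm_sq (norm_one_sub_pos_of_mem_disc (hψ.mapsTo hz)),
      ← mul_assoc (ENNReal.ofReal _) (ENNReal.ofReal _),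
      ← mul_assoc (ENNReal.ofReal _) (ENNReal.ofReal _),
      ← ENNReal.ofReal_mul (by positivity), hid z (mem_disc.1 hz),
      ENNReal.ofReal_mul (by positivity), hφe _ (hψ.mapsTo hz),
      sigma_sigma hc (mem_disc.1 (hmem z hz)), ← mul_assoc, hηη, one_mul]
  have hVm := measurable_V μ
  have hm : Measurable fun z : ℂ => V μ z / ‖1 - l * z‖ₑ ^ 2 := by fun_prop
  rw [lintegral_congr_ae h1, lintegral_const_mul' _ _ ENNReal.ofReal_ne_top,
    ← lintegral_add_left hm]
  calc _ ≤ ENNReal.ofReal (‖l - a‖ ^ 2) *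
        (C * ∫⁻ z, ENNReal.ofReal (quad a l z) * V μ z ∂area) := by
        gcongr; exact h μ a l hα.le hl.le
    _ = C * ∫⁻ z, ENNReal.ofReal (‖l - a‖ ^ 2) * (ENNReal.ofReal (quad a l z) * V μ z) ∂area := by
        rw [mul_left_comm, lintegral_const_mul' _ _ ENNReal.ofReal_ne_top]
    _ ≤ C * ∫⁻ z, 2 * (V μ z / ‖1 - l * z‖ₑ ^ 2 + V μ z / ‖1 - a * z‖ₑ ^ 2) ∂area := by
        gcongr C * ?_
        refine lintegral_mono_ae ?_
        filter_upwards [ae_area_mem_disc] with z hz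
        rw [mem_disc] at hz
        rw [div_enorm_sq (norm_one_sub_mul_pos hl.le hz),
          div_enorm_sq (norm_one_sub_mul_pos hα.le hz), ← add_mul, ← mul_assoc, ← mul_assoc,
          ← ENNReal.ofReal_mul (by positivity), ← ENNReal.ofReal_add (by positivity)
          (by positivity), show (2 : ℝ≥0∞) = ENNReal.ofReal 2 by simp,
          ← ENNReal.ofReal_mul (by norm_num)]
        refine mul_le_mul_left (ENNReal.ofReal_le_ofReal ?_) _
        exact normSq_sub_mul_quad_le hα.le hl.le hz
    _ = _ := by rw [lintegral_const_mul' _ _ (by simp), mul_assoc]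

/-! ### Taylor coefficients and the integral form of the Hilbert operator. -/

theorem hasSum_taylorCoeff {f : ℂ → ℂ} (hf : DifferentiableOn ℂ f disc) {z : ℂ} (hz : ‖z‖ < 1) :
    HasSum (fun k => taylorCoeff f k * z ^ k) (f z) := by
  have := Complex.hasSum_taylorSeries_on_ball hf (mem_disc.2 hz)
  have h : ∀ k, taylorCoeff f k * z ^ k =
      (k.factorial : ℂ)⁻¹ • (z - 0) ^ k • iteratedDeriv k f 0 := fun k => by
    rw [taylorCoeff, sub_zero, smul_eq_mul, smul_eq_mul]
    ring
  simpa only [h] using this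

/-- Bessel's inequality for the Taylor coefficients of a bounded analytic function. -/
theorem sum_norm_taylorCoeff_sq_le {f : ℂ → ℂ} (hf : DifferentiableOn ℂ f disc) {C : ℝ}
    (hC : ∀ z ∈ disc, ‖f z‖ ≤ C) (N : ℕ) :
    ∑ k ∈ Finset.range N, ‖taylorCoeff f k‖ ^ 2 ≤ C ^ 2 := by
  have hC0 : 0 ≤ C := (norm_nonneg _).trans (hC 0 (by simp))
  -- On a circle of radius `r < 1` the Taylor polynomials are within the absolute tail `T M` of `f`.
  -- Parseval for polynomials applies there; then `M → ∞` and `r → 1`.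
  have hr : ∀ r : ℝ, 0 ≤ r → r < 1 →
      ∑ k ∈ Finset.range N, (‖taylorCoeff f k‖ * r ^ k) ^ 2 ≤ C ^ 2 := by
    intro r h0 h1
    have hs : Summable fun k => ‖taylorCoeff f k‖ * r ^ k := by
      have := (hasSum_taylorCoeff hf (z := r) (by simpa [abs_of_nonneg h0] using h1)).summable.norm
      simpa [abs_of_nonneg h0] using this
    set T : ℕ → ℝ := fun M => ∑' k, ‖taylorCoeff f (k + M)‖ * r ^ (k + M) with hT
    have hT0 : Tendsto T atTop (𝓝 0) := tendsto_sum_nat_add fun k => ‖taylorCoeff f k‖ * r ^ k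
    have hM : ∀ M, N ≤ M →
        ∑ k ∈ Finset.range N, (‖taylorCoeff f k‖ * r ^ k) ^ 2 ≤ (C + T M) ^ 2 := by
      intro M hNM
      set p : Polynomial ℂ := ∑ k ∈ Finset.range M,
        Polynomial.monomial k (taylorCoeff f k * (r : ℂ) ^ k) with hp
      have hcoef : ∀ k < M, p.coeff k = taylorCoeff f k * (r : ℂ) ^ k := by
        intro k hk
        simp [hp, Polynomial.finsetSum_coeff, Polynomial.coeff_monomial, hk]
      have h2 : ∑ k ∈ Finset.range N, (‖taylorCoeff f k‖ * r ^ k) ^ 2 ≤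
          ∑ i ∈ p.support, ‖p.coeff i‖ ^ 2 := by
        rw [Finset.sum_congr rfl (g := fun k => ‖p.coeff k‖ ^ 2) fun k hk => ?_]
        · rw [← Finset.sum_filter_ne_zero]
          refine Finset.sum_le_sum_of_subset_of_nonneg (fun k hk => ?_) fun _ _ _ => by positivity
          simpa using (Finset.mem_filter.1 hk).2
        · rw [hcoef k ((Finset.mem_range.1 hk).trans_le hNM)]
          simp [abs_of_nonneg h0]
      rw [Polynomial.sum_sq_norm_coeff_eq_circleAverage] at h2
      refine h2.trans (Real.circleAverage_mono_on_of_le_circle ?_ fun x hx => ?_)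
      · refine ContinuousOn.circleIntegrable' ?_
        fun_prop
      · rw [abs_one, mem_sphere_zero_iff_norm] at hx
        have hx1 : ‖(r : ℂ) * x‖ < 1 := by simpa [hx, abs_of_nonneg h0] using h1
        have hsum := hasSum_taylorCoeff hf hx1
        have heval : p.eval x = ∑ k ∈ Finset.range M, taylorCoeff f k * (r * x) ^ k := by
          simp [hp, Polynomial.eval_finsetSum, mul_pow, mul_assoc]
        have hsplit := hsum.summable.sum_add_tsum_nat_add M
        rw [hsum.tsum_eq, ← heval] at hsplit
        have htail : ‖∑' k, taylorCoeff f (k + M) * (r * x) ^ (k + M)‖ ≤ T M := by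
          refine tsum_of_norm_bounded ((summable_nat_add_iff M).2 hs).hasSum fun k => ?_
          simp [hx, abs_of_nonneg h0]
        have : ‖p.eval x‖ ≤ C + T M := by
          rw [eq_sub_of_add_eq hsplit]
          exact (norm_sub_le _ _).trans (add_le_add (hC _ (mem_disc.2 hx1)) htail)
        gcongr
    have hlim : Tendsto (fun M => (C + T M) ^ 2) atTop (𝓝 ((C + 0) ^ 2)) :=
      (tendsto_const_nhds.add hT0).pow 2
    rw [add_zero] at hlim
    exact ge_of_tendsto hlim ((eventually_ge_atTop N).mono hM)
  have hlim : Tendsto (fun r : ℝ => ∑ k ∈ Finset.range N, (‖taylorCoeff f k‖ * r ^ k) ^ 2)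
      (𝓝[<] 1) (𝓝 (∑ k ∈ Finset.range N, (‖taylorCoeff f k‖ * 1 ^ k) ^ 2)) := by
    refine (Continuous.tendsto ?_ 1).mono_left nhdsWithin_le_nhds
    fun_prop
  simp only [one_pow, mul_one] at hlim
  refine le_of_tendsto hlim ?_
  filter_upwards [Ioo_mem_nhdsLT (show (0 : ℝ) < 1 by norm_num)] with r h
  exact hr r h.1.le h.2

/-- Both `aₖ` and `1/(k + 1)` are square summable. -/
theorem summable_norm_taylorCoeff_div {f : ℂ → ℂ} (hf : MemHInfty f) (n : ℕ) :
    Summable fun k : ℕ => ‖taylorCoeff f k‖ * ((k + n : ℕ) + 1 : ℝ)⁻¹ := by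
  obtain ⟨hd, C, hC⟩ := hf
  have h1 : Summable fun k : ℕ => ‖taylorCoeff f k‖ ^ 2 :=
    summable_of_sum_range_le (fun _ => by positivity) (sum_norm_taylorCoeff_sq_le hd hC)
  have h2 : Summable fun k : ℕ => (((k : ℝ) + 1) ^ 2)⁻¹ := by
    have := (summable_nat_add_iff 1).2 (Real.summable_nat_pow_inv.2 (show 1 < 2 by norm_num))
    simpa using this
  refine (h1.add h2).of_nonneg_of_le (fun k => by positivity) fun k => ?_
  have h3 : ((k + n : ℕ) + 1 : ℝ)⁻¹ ≤ ((k : ℝ) + 1)⁻¹ := by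
    gcongr; linarith [(Nat.cast_nonneg n : (0 : ℝ) ≤ n)]
  have h4 : ‖taylorCoeff f k‖ * ((k + n : ℕ) + 1 : ℝ)⁻¹ ≤
      ‖taylorCoeff f k‖ * ((k : ℝ) + 1)⁻¹ := by gcongr
  rw [← inv_pow]
  nlinarith [sq_nonneg (‖taylorCoeff f k‖ - ((k : ℝ) + 1)⁻¹), sq_nonneg ‖taylorCoeff f k‖,
    sq_nonneg ((k : ℝ) + 1)⁻¹]

theorem setIntegral_Ioo_pow (m : ℕ) : ∫ t in Ioo (0 : ℝ) 1, t ^ m = ((m : ℝ) + 1)⁻¹ := by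
  rw [← integral_Ioc_eq_integral_Ioo, ← intervalIntegral.integral_of_le zero_le_one, integral_pow]
  simp

theorem integrableOn_Ioo_of_bounded {g : ℝ → ℂ} (hg : ContinuousOn g (Ioo 0 1)) {C : ℝ}
    (hC : ∀ t ∈ Ioo (0 : ℝ) 1, ‖g t‖ ≤ C) : IntegrableOn g (Ioo 0 1) :=
  Integrable.of_bound (hg.aestronglyMeasurable measurableSet_Ioo) C
    ((ae_restrict_iff' measurableSet_Ioo).2 (.of_forall hC))

theorem norm_ofReal_lt_one {t : ℝ} (ht : t ∈ Ioo (0 : ℝ) 1) : ‖(t : ℂ)‖ < 1 := by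
  simpa [abs_of_pos ht.1] using ht.2

theorem continuousOn_comp_ofReal {f : ℂ → ℂ} (hf : DifferentiableOn ℂ f disc) :
    ContinuousOn (fun t : ℝ => f t) (Ioo 0 1) :=
  hf.continuousOn.comp Complex.continuous_ofReal.continuousOn fun _ ht =>
    mem_disc.2 (norm_ofReal_lt_one ht)

/-- The rows of the Hilbert matrix act as moments. -/
theorem tsum_taylorCoeff_div {f : ℂ → ℂ} (hf : MemHInfty f) (n : ℕ) :
    ∑' k : ℕ, taylorCoeff f k / ((k : ℂ) + (n : ℂ) + 1) =
      ∫ t in Ioo (0 : ℝ) 1, (t : ℂ) ^ n * f t := by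
  have hint : ∀ k : ℕ, IntegrableOn (fun t : ℝ => taylorCoeff f k * (t : ℂ) ^ (k + n)) (Ioo 0 1) :=
    fun k => integrableOn_Ioo_of_bounded (by fun_prop) (C := ‖taylorCoeff f k‖) fun t ht => by
      rw [norm_mul, norm_pow]
      exact mul_le_of_le_one_right (norm_nonneg _)
        (pow_le_one₀ (norm_nonneg _) (norm_ofReal_lt_one ht).le)
  have hnorm : ∀ k : ℕ, ∫ t in Ioo (0 : ℝ) 1, ‖taylorCoeff f k * (t : ℂ) ^ (k + n)‖ =
      ‖taylorCoeff f k‖ * ((k + n : ℕ) + 1 : ℝ)⁻¹ := fun k => by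
    rw [← setIntegral_Ioo_pow, ← integral_const_mul]
    refine setIntegral_congr_fun measurableSet_Ioo fun t ht => ?_
    simp [abs_of_pos ht.1]
  have h := hasSum_integral_of_summable_integral_norm hint
    (by simpa only [hnorm] using summable_norm_taylorCoeff_div hf n)
  have hterm : ∀ k : ℕ, ∫ t in Ioo (0 : ℝ) 1, taylorCoeff f k * (t : ℂ) ^ (k + n) =
      taylorCoeff f k / ((k : ℂ) + (n : ℂ) + 1) := fun k => by
    have h1 : ∫ t in Ioo (0 : ℝ) 1, (t : ℂ) ^ (k + n) = (((k + n : ℕ) : ℝ) + 1 : ℝ)⁻¹ := by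
      rw [← setIntegral_Ioo_pow, ← integral_complex_ofReal]
      simp
    rw [integral_const_mul, h1, div_eq_mul_inv]
    push_cast; ring
  rw [← (funext hterm : _), h.tsum_eq]
  refine setIntegral_congr_fun measurableSet_Ioo fun t ht => ?_
  simp only [pow_add, ← mul_assoc]
  rw [tsum_mul_right, (hasSum_taylorCoeff hf.1 (norm_ofReal_lt_one ht)).tsum_eq, mul_comm]

theorem norm_ofReal_mul_lt_one {t : ℝ} (ht : t ∈ Ioo (0 : ℝ) 1) {z : ℂ} (hz : ‖z‖ < 1) :
    ‖(t : ℂ) * z‖ < 1 := by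
  rw [norm_mul]
  exact mul_lt_one_of_nonneg_of_lt_one_left (norm_nonneg _) (norm_ofReal_lt_one ht) hz.le

theorem hilbert_eq_integral {f : ℂ → ℂ} (hf : MemHInfty f) {z : ℂ} (hz : ‖z‖ < 1) :
    hilbert f z = ∫ t in Ioo (0 : ℝ) 1, f t * (1 - t * z)⁻¹ := by
  obtain ⟨C, hC⟩ := hf.2
  have hC0 : 0 ≤ C := (norm_nonneg _).trans (hC 0 (by simp))
  have hcont := continuousOn_comp_ofReal hf.1
  have hbd : ∀ n : ℕ, ∀ t ∈ Ioo (0 : ℝ) 1, ‖(t : ℂ) ^ n * f t * z ^ n‖ ≤ C * ‖z‖ ^ n := by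
    intro n t ht
    rw [norm_mul, norm_mul, norm_pow, norm_pow]
    gcongr
    calc _ ≤ 1 * C := by
          gcongr
          · exact pow_le_one₀ (norm_nonneg _) (norm_ofReal_lt_one ht).le
          · exact hC _ (mem_disc.2 (norm_ofReal_lt_one ht))
      _ = C := one_mul C
  have hint : ∀ n : ℕ, IntegrableOn (fun t : ℝ => (t : ℂ) ^ n * f t * z ^ n) (Ioo 0 1) :=
    fun n => integrableOn_Ioo_of_bounded
      ((ContinuousOn.mul (by fun_prop) hcont).mul continuousOn_const) (hbd n)
  have hsum : Summable fun n : ℕ => ∫ t in Ioo (0 : ℝ) 1, ‖(t : ℂ) ^ n * f t * z ^ n‖ := by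
    refine ((summable_geometric_of_lt_one (norm_nonneg z) hz).mul_left C).of_nonneg_of_le
      (fun n => integral_nonneg fun _ => norm_nonneg _) fun n => ?_
    calc _ ≤ ∫ t in Ioo (0 : ℝ) 1, C * ‖z‖ ^ n :=
          setIntegral_mono_on (hint n).norm (integrable_const _) measurableSet_Ioo (hbd n)
      _ = C * ‖z‖ ^ n := by simp
  have h := hasSum_integral_of_summable_integral_norm hint hsum
  rw [hilbert]
  simp only [tsum_taylorCoeff_div hf, ← integral_mul_const]
  rw [h.tsum_eq]
  refine setIntegral_congr_fun measurableSet_Ioo fun t ht => ?_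
  have : ∀ n : ℕ, (t : ℂ) ^ n * f t * z ^ n = f t * (t * z) ^ n := fun n => by
    rw [mul_pow]; ring
  simp only [this]
  rw [tsum_mul_left, tsum_geometric_of_norm_lt_one (norm_ofReal_mul_lt_one ht hz)]

/-! ### Two-sided bounds for the derivative of the Hilbert transform. -/

theorem one_sub_norm_le {t : ℝ} (ht : t ∈ Ioo (0 : ℝ) 1) (z : ℂ) : 1 - ‖z‖ ≤ ‖1 - t * z‖ := by
  have := norm_sub_norm_le (1 : ℂ) (t * z)
  rw [norm_one, norm_mul] at this
  nlinarith [norm_nonneg z, norm_ofReal_lt_one ht]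

theorem hasDerivAt_hilbert {f : ℂ → ℂ} (hf : MemHInfty f) {w : ℂ} (hw : ‖w‖ < 1) :
    HasDerivAt (hilbert f) (∫ t in Ioo (0 : ℝ) 1, f t * (t / (1 - t * w) ^ 2)) w := by
  obtain ⟨C, hC⟩ := hf.2
  have hC0 : 0 ≤ C := (norm_nonneg _).trans (hC 0 (by simp))
  have hcont := continuousOn_comp_ofReal hf.1
  -- Half the distance to the circle: `|1 - tz| ≥ δ` uniformly for `z` in the ball, which dominates
  -- the differentiated integrand.
  set δ := (1 - ‖w‖) / 2 with hδ
  have hδ0 : 0 < δ := by rw [hδ]; linarith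
  have hlow : ∀ z ∈ Metric.ball w δ, ∀ t ∈ Ioo (0 : ℝ) 1, δ ≤ ‖1 - t * z‖ := by
    intro z hz t ht
    rw [mem_ball_iff_norm] at hz
    have := norm_sub_norm_le z w
    have := one_sub_norm_le ht z
    linarith
  have hne : ∀ z ∈ Metric.ball w δ, ∀ t ∈ Ioo (0 : ℝ) 1, 1 - (t : ℂ) * z ≠ 0 :=
    fun z hz t ht => norm_pos_iff.1 (hδ0.trans_le (hlow z hz t ht))
  have hball : Metric.ball w δ ∈ 𝓝 w := Metric.ball_mem_nhds w hδ0
  have hF : ∀ z ∈ Metric.ball w δ,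
      ContinuousOn (fun t : ℝ => f t * (1 - t * z)⁻¹) (Ioo 0 1) := fun z hz =>
    hcont.mul (ContinuousOn.inv₀ (by fun_prop) (hne z hz))
  have hwb := Metric.mem_ball_self hδ0 (x := w)
  have key := (hasDerivAt_integral_of_dominated_loc_of_deriv_le
    (μ := volume.restrict (Ioo (0 : ℝ) 1)) (F := fun (z : ℂ) t => f t * (1 - t * z)⁻¹)
    (F' := fun (z : ℂ) t => f t * (t / (1 - t * z) ^ 2)) (x₀ := w) (bound := fun _ => C * (δ ^ 2)⁻¹)
    hball ?_ ?_ ?_ ?_ (integrable_const _) ?_).2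
  · refine key.congr_of_eventuallyEq ?_
    filter_upwards [Metric.isOpen_ball.mem_nhds (mem_disc.2 hw)] with z hz
    exact hilbert_eq_integral hf (mem_disc.1 hz)
  · filter_upwards [hball] with z hz
    exact (hF z hz).aestronglyMeasurable measurableSet_Ioo
  · refine integrableOn_Ioo_of_bounded (hF w hwb) (C := C * δ⁻¹) fun t ht => ?_
    rw [norm_mul, norm_inv]
    gcongr
    · exact hC _ (mem_disc.2 (norm_ofReal_lt_one ht))
    · exact hlow w hwb t ht
  · refine ContinuousOn.aestronglyMeasurable ?_ measurableSet_Ioo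
    exact hcont.mul (ContinuousOn.div (by fun_prop) (by fun_prop)
      fun t ht => pow_ne_zero 2 (hne w hwb t ht))
  · refine (ae_restrict_iff' measurableSet_Ioo).2 (.of_forall fun t ht z hz => ?_)
    rw [norm_mul, norm_div, norm_pow, div_eq_mul_inv]
    gcongr
    · exact hC _ (mem_disc.2 (norm_ofReal_lt_one ht))
    · refine (mul_le_of_le_one_left (by positivity) (norm_ofReal_lt_one ht).le).trans ?_
      gcongr
      exact hlow z hz t ht
  · refine (ae_restrict_iff' measurableSet_Ioo).2 (.of_forall fun t ht z hz => ?_)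
    have h1 : HasDerivAt (fun z : ℂ => 1 - t * z) (-t) z := by
      simpa using ((hasDerivAt_id z).const_mul (t : ℂ)).const_sub 1
    refine ((h1.inv (hne z hz t ht)).const_mul (f t)).congr_deriv ?_
    rw [neg_neg]

theorem differentiableOn_hilbert {f : ℂ → ℂ} (hf : MemHInfty f) :
    DifferentiableOn ℂ (hilbert f) disc := fun _ hz =>
  (hasDerivAt_hilbert hf (mem_disc.1 hz)).differentiableAt.differentiableWithinAt

theorem norm_deriv_hilbert_le {f : ℂ → ℂ} (hf : MemHInfty f) :
    ∃ K : ℝ, ∀ w ∈ disc, ‖deriv (hilbert f) w‖ ≤ K * ‖1 - w‖⁻¹ := by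
  obtain ⟨C, hC⟩ := hf.2
  have hC0 : 0 ≤ C := (norm_nonneg _).trans (hC 0 (by simp))
  refine ⟨C * 9, fun w hw => ?_⟩
  have hd := norm_one_sub_pos_of_mem_disc hw
  rw [mem_disc] at hw
  rw [(hasDerivAt_hilbert hf hw).deriv]
  set d := ‖1 - w‖
  have hpos : ∀ t ∈ Icc (0 : ℝ) 1, 0 < 1 - t + d := fun t ht => by linarith [ht.2]
  have hbd : ∀ t ∈ Ioo (0 : ℝ) 1, ‖f t * (t / (1 - t * w) ^ 2)‖ ≤ C * 9 / (1 - t + d) ^ 2 := by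
    intro t ht
    have ht1 := norm_ofReal_lt_one ht
    have h1 : 1 - t ≤ ‖1 - t * w‖ := by
      have := norm_sub_norm_le (1 : ℂ) (t * w)
      rw [norm_one, norm_mul, Complex.norm_real, Real.norm_of_nonneg ht.1.le] at this
      nlinarith [ht.1, ht.2]
    have h2 : d ≤ ‖1 - t * w‖ + (1 - t) := by
      have h3 : 1 - w = (1 - t * w) - ((1 - t : ℝ) : ℂ) * w := by push_cast; ring
      have h4 := norm_sub_le (1 - t * w) (((1 - t : ℝ) : ℂ) * w)
      rw [← h3, norm_mul, Complex.norm_real, Real.norm_of_nonneg (by linarith [ht.2])] at h4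
      nlinarith [ht.2]
    -- The previous two bounds give `d ≤ 2|1 - tw|`, hence the 3. It remains to use `∫₀¹ (1 - t +
    -- d)⁻² dt ≤ 1/d`.
    have h5 : (1 - t + d) / 3 ≤ ‖1 - t * w‖ := by linarith
    have h6 := hpos t ⟨ht.1.le, ht.2.le⟩
    rw [norm_mul, norm_div, norm_pow, mul_div_assoc]
    refine mul_le_mul (hC _ (mem_disc.2 ht1)) ?_ (by positivity) hC0
    calc ‖(t : ℂ)‖ / ‖1 - t * w‖ ^ 2 ≤ 1 / ((1 - t + d) / 3) ^ 2 := by gcongr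
      _ = 9 / (1 - t + d) ^ 2 := by field_simp; norm_num
  have hderiv : ∀ t ∈ uIcc (0 : ℝ) 1,
      HasDerivAt (fun t => C * 9 / (1 - t + d)) (C * 9 / (1 - t + d) ^ 2) t := by
    intro t ht
    rw [uIcc_of_le zero_le_one] at ht
    have h1 : HasDerivAt (fun t : ℝ => 1 - t + d) (-1) t :=
      ((hasDerivAt_id t).const_sub 1).add_const d
    refine ((hasDerivAt_const t (C * 9)).div h1 (hpos t ht).ne').congr_deriv ?_
    ring
  have hci : ContinuousOn (fun t : ℝ => C * 9 / (1 - t + d) ^ 2) (Icc 0 1) :=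
    ContinuousOn.div (by fun_prop) (by fun_prop) fun t ht => (pow_pos (hpos t ht) 2).ne'
  have hint := intervalIntegral.integral_eq_sub_of_hasDerivAt hderiv
    (ContinuousOn.intervalIntegrable (by rwa [uIcc_of_le zero_le_one]))
  refine (norm_integral_le_of_norm_le (hci.integrableOn_Icc.mono_set Ioo_subset_Icc_self)
    ((ae_restrict_iff' measurableSet_Ioo).2 (.of_forall hbd))).trans ?_
  rw [← integral_Ioc_eq_integral_Ioo, ← intervalIntegral.integral_of_le zero_le_one, hint]
  have : 0 ≤ C * 9 / (1 - 0 + d) := by positivity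
  simp only [sub_self, zero_add]
  rw [← div_eq_mul_inv]
  linarith

theorem memHInfty_one : MemHInfty fun _ => 1 := ⟨by fun_prop, 1, by simp⟩

/-- Inversion maps the disc `|1 - v| ≤ 1`, punctured at 0, to the half-plane `Re ≥ 1/2`. -/
theorem half_le_re_inv {v : ℂ} (h0 : v ≠ 0) (h : ‖1 - v‖ ≤ 1) : 1 / 2 ≤ (v⁻¹).re := by
  have h1 : ‖1 - v‖ ^ 2 ≤ 1 := pow_le_one₀ (norm_nonneg _) h
  have h2 := Complex.normSq_pos.2 h0
  rw [← Complex.normSq_eq_norm_sq, Complex.normSq_apply] at h1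
  rw [Complex.inv_re, le_div_iff₀ h2]
  rw [Complex.normSq_apply]
  simp only [Complex.sub_re, Complex.sub_im, Complex.one_re, Complex.one_im] at h1
  nlinarith

theorem le_norm_deriv_hilbert_one {w : ℂ} (hw : w ∈ disc) :
    ‖1 - w‖⁻¹ ≤ 4 * ‖deriv (hilbert fun _ => 1) w‖ := by
  have hd := norm_one_sub_pos_of_mem_disc hw
  rw [mem_disc] at hw
  rw [(hasDerivAt_hilbert memHInfty_one hw).deriv, inv_le_iff_one_le_mul₀ hd]
  simp only [one_mul]
  have hne : ∀ t ∈ Icc (0 : ℝ) 1, 1 - (t : ℂ) * w ≠ 0 := fun t ht =>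
    one_sub_mul_ne_zero (by simpa [abs_of_nonneg ht.1] using ht.2) hw
  have hc1 : ContinuousOn (fun t : ℝ => (1 - w) * (t / (1 - t * w) ^ 2)) (Icc 0 1) :=
    continuousOn_const.mul (ContinuousOn.div (by fun_prop) (by fun_prop)
      fun t ht => pow_ne_zero 2 (hne t ht))
  have hc2 : ContinuousOn (fun t : ℝ => (1 - t : ℂ) * (1 - t * w)⁻¹) (Icc 0 1) :=
    ContinuousOn.mul (by fun_prop) (ContinuousOn.inv₀ (by fun_prop) hne)
  -- Integration by parts: `t² - t` vanishes at both endpoints, so `(1 - w)∫ t/(1 - tw)² = ∫ (1 -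
  -- t)/(1 - tw)`. The latter has real part at least `∫ (1 - t)/2 = 1/4`.
  have hderiv : ∀ t ∈ uIcc (0 : ℝ) 1, HasDerivAt (fun t : ℝ => ((t : ℂ) ^ 2 - t) / (1 - t * w))
      ((1 - w) * (t / (1 - t * w) ^ 2) - (1 - t : ℂ) * (1 - t * w)⁻¹) t := by
    intro t ht
    rw [uIcc_of_le zero_le_one] at ht
    have h1 : HasDerivAt (fun z : ℂ => (z ^ 2 - z) / (1 - z * w))
      ((1 - w) * (t / (1 - t * w) ^ 2) - (1 - t : ℂ) * (1 - t * w)⁻¹) t := by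
      have h2 : HasDerivAt (fun z : ℂ => 1 - z * w) (-w) t := by
        simpa using ((hasDerivAt_id (t : ℂ)).mul_const w).const_sub 1
      have h3 : HasDerivAt (fun z : ℂ => z ^ 2 - z) (2 * t - 1) t := by
        exact ((hasDerivAt_pow 2 (t : ℂ)).sub (hasDerivAt_id (t : ℂ))).congr_deriv (by simp)
      refine (h3.div h2 (hne t ht)).congr_deriv ?_
      have h4 := hne t ht
      rw [inv_eq_one_div, mul_div_assoc', mul_div_assoc', div_sub_div _ _ (pow_ne_zero 2 h4) h4,
        div_eq_div_iff (pow_ne_zero 2 h4) (mul_ne_zero (pow_ne_zero 2 h4) h4)]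
      ring
    exact h1.comp_ofReal
  have hparts := intervalIntegral.integral_eq_sub_of_hasDerivAt hderiv
    (ContinuousOn.intervalIntegrable (by rw [uIcc_of_le zero_le_one]; exact hc1.sub hc2))
  rw [intervalIntegral.integral_of_le zero_le_one, integral_Ioc_eq_integral_Ioo,
    integral_sub (hc1.integrableOn_Icc.mono_set Ioo_subset_Icc_self)
      (hc2.integrableOn_Icc.mono_set Ioo_subset_Icc_self), integral_const_mul] at hparts
  have heq : (1 - w) * ∫ t in Ioo (0 : ℝ) 1, (t : ℂ) / (1 - t * w) ^ 2 =
      ∫ t in Ioo (0 : ℝ) 1, (1 - t : ℂ) * (1 - t * w)⁻¹ := by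
    rw [← sub_eq_zero, hparts]; simp
  have hre : 1 / 4 ≤ (∫ t in Ioo (0 : ℝ) 1, (1 - t : ℂ) * (1 - t * w)⁻¹).re := by
    have hi := (hc2.integrableOn_Icc (μ := volume)).mono_set Ioo_subset_Icc_self
    have h1 : ∫ t in Ioo (0 : ℝ) 1, (1 - t) * (1 / 2) = 1 / 4 := by
      rw [← integral_Ioc_eq_integral_Ioo, ← intervalIntegral.integral_of_le zero_le_one,
        intervalIntegral.integral_mul_const, intervalIntegral.integral_sub (by simp) (by simp)]
      simp; norm_num
    rw [← h1]
    have h2 := integral_re hi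
    simp only [RCLike.re_eq_complex_re] at h2
    rw [← h2]
    refine setIntegral_mono_on ?_ hi.re measurableSet_Ioo fun t ht => ?_
    · have h3 : Continuous fun t : ℝ => (1 - t) * (1 / 2) := by fun_prop
      exact (h3.integrableOn_Icc (μ := volume)).mono_set Ioo_subset_Icc_self
    · have h3 := half_le_re_inv (hne t ⟨ht.1.le, ht.2.le⟩)
        (by simpa using (norm_ofReal_mul_lt_one ht hw).le)
      have h4 : ((1 - t : ℂ) * (1 - t * w)⁻¹).re = (1 - t) * ((1 - t * w)⁻¹ : ℂ).re := by
        rw [← Complex.re_ofReal_mul]; push_cast; rfl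
      rw [h4]
      exact mul_le_mul_of_nonneg_left h3 (by linarith [ht.2])
  have h5 := hre.trans ((Complex.re_le_norm _).trans_eq (by rw [← heq, norm_mul]))
  linarith

/-- `H` maps `H^∞` into `M(D_μ)` exactly when `log (1 - z)` is in `M(D_μ)`. -/
theorem hilbert_memMD_iff (μ : Measure ℂ) :
    (∀ f : ℂ → ℂ, MemHInfty f → MemMD μ (hilbert f)) ↔
      MemMD μ fun z : ℂ => Complex.log (1 - z) := by
  have hlog : ∀ w ∈ disc, ‖deriv (fun z : ℂ => Complex.log (1 - z)) w‖ = ‖1 - w‖⁻¹ :=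
    fun w hw => by rw [(hasDerivAt_log_one_sub hw).deriv, norm_neg, norm_inv]
  refine ⟨fun h => (h _ memHInfty_one).mono (K := 4) (fun z hz =>
    (hasDerivAt_log_one_sub hz).differentiableAt.differentiableWithinAt) fun w hw => ?_,
    fun h f hf => ?_⟩
  · rw [hlog w hw]; exact le_norm_deriv_hilbert_one hw
  · obtain ⟨K, hK⟩ := norm_deriv_hilbert_le hf
    exact h.mono (differentiableOn_hilbert hf) fun w hw => by rw [hlog w hw]; exact hK w hw

/-! ### The cycle of implications for the logarithm and the two suprema. -/

theorem MemMD.lintegral_V_circle_lt_top {μ : Measure ℂ}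
    (h : MemMD μ fun z : ℂ => Complex.log (1 - z)) :
    (⨆ l ∈ circle, ∫⁻ z, V μ z / ‖1 - l * z‖ₑ ^ 2 ∂area) < ⊤ := by
  obtain ⟨C, hC, hb⟩ := memMD_log_iff.1 h
  refine (iSup₂_le fun l hl => ?_).trans_lt hC.lt_top
  have hl1 : ‖l‖ = 1 := by simpa [circle] using hl
  have hc1 : ‖conj l‖ = 1 := by simpa using hl1
  have hll : l * conj l = 1 := by rw [Complex.mul_conj, Complex.normSq_eq_norm_sq, hl1]; simp
  have hφ := isDiscAut_const_mul hc1
  have hd : ∀ z ∈ disc, HasDerivAt (fun z => conj l * z) (conj l) z := fun z _ => by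
    simpa using (hasDerivAt_id z).const_mul (conj l)
  refine le_trans ?_ (hb _ hφ)
  rw [lintegral_area_comp hφ.2 hd]
  refine lintegral_mono_ae ?_
  filter_upwards [ae_area_mem_disc] with w hw
  rw [hc1, one_pow, ENNReal.ofReal_one, one_mul, ← mul_assoc, hll, one_mul]
  gcongr
  exact V_le_U μ (mem_disc.1 (hφ.2.mapsTo hw))

theorem lintegral_V_disc_lt_top_of_circle {μ : Measure ℂ}
    (h : (⨆ l ∈ circle, ∫⁻ z, V μ z / ‖1 - l * z‖ₑ ^ 2 ∂area) < ⊤) :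
    (⨆ a ∈ disc, ∫⁻ z, V μ z / ‖1 - a * z‖ₑ ^ 2 ∂area) < ⊤ := by
  refine (iSup₂_le fun a ha => ?_).trans_lt (ENNReal.mul_lt_top (a := 4) (by simp) h)
  rw [mem_disc] at ha
  obtain ⟨l, hl, r, hr0, hr1, rfl⟩ : ∃ l : ℂ, ‖l‖ = 1 ∧ ∃ r : ℝ, 0 ≤ r ∧ r < 1 ∧ a = r * l := by
    rcases eq_or_ne a 0 with rfl | h0
    · exact ⟨1, by simp, 0, by simp⟩
    · have h1 : (‖a‖ : ℂ) ≠ 0 := by simpa using h0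
      exact ⟨a / ‖a‖, by simp [h0], ‖a‖, norm_nonneg a, ha, by field_simp⟩
  refine le_trans ?_ (mul_le_mul_right (le_iSup₂_of_le l (by simpa [circle] using hl) le_rfl) _)
  rw [← lintegral_const_mul' _ _ (by simp)]
  refine lintegral_mono_ae ?_
  filter_upwards [ae_area_mem_disc] with z hz
  rw [mem_disc] at hz
  have hp := norm_one_sub_mul_pos ha.le hz
  have hq := norm_one_sub_mul_pos hl.le hz
  rw [div_enorm_sq hp, div_enorm_sq hq, ← mul_assoc,
    show (4 : ℝ≥0∞) = ENNReal.ofReal 4 by simp, ← ENNReal.ofReal_mul (by norm_num)]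
  refine mul_le_mul_left (ENNReal.ofReal_le_ofReal ?_) _
  -- The error `(1 - r)lz` is at most `1 - r ≤ |1 - rlz|`. Squaring the factor 2 gives the 4 above.
  have h1 : ‖1 - l * z‖ ≤ 2 * ‖1 - r * l * z‖ := by
    have h2 : 1 - l * z = (1 - r * l * z) - ((1 - r : ℝ) : ℂ) * (l * z) := by push_cast; ring
    have h3 := norm_sub_le (1 - r * l * z) (((1 - r : ℝ) : ℂ) * (l * z))
    rw [← h2, norm_mul, norm_mul, hl, Complex.norm_real, Real.norm_of_nonneg (by linarith)] at h3
    have h4 := norm_sub_norm_le (1 : ℂ) (r * l * z)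
    rw [norm_one, norm_mul, norm_mul, hl, Complex.norm_real, Real.norm_of_nonneg hr0] at h4
    nlinarith
  rw [← div_eq_mul_inv, le_div_iff₀ (by positivity), ← div_eq_inv_mul, div_le_iff₀ (by positivity)]
  nlinarith

/-- Take `a = 0`: the plain area integral of `V` is finite, and the disc has positive area. -/
theorem exists_V_ne_top {μ : Measure ℂ}
    (h : (⨆ a ∈ disc, ∫⁻ z, V μ z / ‖1 - a * z‖ₑ ^ 2 ∂area) < ⊤) : ∃ z ∈ disc, V μ z ≠ ⊤ := by
  by_contra! hV
  have h1 := (le_iSup₂_of_le (f := fun a (_ : a ∈ disc) =>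
    ∫⁻ z, V μ z / ‖1 - a * z‖ₑ ^ 2 ∂area) 0 (by simp) le_rfl).trans_lt h
  simp only [zero_mul, sub_zero, enorm_one, one_pow, div_one] at h1
  rw [lintegral_congr_ae (g := fun _ => ⊤)
    (by filter_upwards [ae_area_mem_disc] with z hz using hV z hz), lintegral_const,
    ENNReal.top_mul] at h1
  · exact lt_irrefl _ h1
  · intro h0
    have := measure_mono_null (subset_univ disc) h0
    rw [area_disc] at this
    exact one_ne_zero this

/-- Fatou's lemma along radial points `rₙl → l`. It requires `V` measurable, hence the preliminary
s-finiteness. -/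
theorem lintegral_V_circle_lt_top_of_disc {μ : Measure ℂ}
    (h : (⨆ a ∈ disc, ∫⁻ z, V μ z / ‖1 - a * z‖ₑ ^ 2 ∂area) < ⊤) :
    (⨆ l ∈ circle, ∫⁻ z, V μ z / ‖1 - l * z‖ₑ ^ 2 ∂area) < ⊤ := by
  obtain ⟨z₀, hz₀, hV⟩ := exists_V_ne_top h
  have := sFinite_restrict_of_V_ne_top (mem_disc.1 hz₀) hV
  have hVm := measurable_V μ
  refine (iSup₂_le fun l hl => ?_).trans_lt h
  have hl1 : ‖l‖ = 1 := by simpa [circle] using hl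
  set r : ℕ → ℂ := fun n => ((1 - 1 / ((n : ℝ) + 1) : ℝ) : ℂ) with hr
  have hr1 : ∀ n, ‖r n‖ < 1 := fun n => by
    have h1 : 0 < 1 / ((n : ℝ) + 1) := by positivity
    have h2 : 1 / ((n : ℝ) + 1) ≤ 1 := by rw [div_le_one (by positivity)]; simp
    rw [hr, Complex.norm_real, Real.norm_of_nonneg (by linarith)]
    linarith
  have hrt : Tendsto r atTop (𝓝 1) := by
    have h1 := tendsto_one_div_add_atTop_nhds_zero_nat (𝕜 := ℝ)
    rw [← Complex.ofReal_one, ← sub_zero (1 : ℝ)]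
    exact (Complex.continuous_ofReal.tendsto _).comp (h1.const_sub 1)
  have hmem : ∀ n, r n * l ∈ disc := fun n => by
    rw [mem_disc, norm_mul, hl1, mul_one]; exact hr1 n
  have hlim : ∀ᵐ z ∂area, V μ z / ‖1 - l * z‖ₑ ^ 2 =
      liminf (fun n => V μ z / ‖1 - r n * l * z‖ₑ ^ 2) atTop := by
    filter_upwards [ae_area_mem_disc] with z hz
    have hz' := mem_disc.1 hz
    refine (Tendsto.liminf_eq ?_).symm
    have h1 : Tendsto (fun n => ‖1 - r n * l * z‖ₑ ^ 2) atTop (𝓝 (‖1 - l * z‖ₑ ^ 2)) := by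
      have h2 : Tendsto (fun n => 1 - r n * l * z) atTop (𝓝 (1 - 1 * l * z)) :=
        ((hrt.mul_const l).mul_const z).const_sub 1
      rw [one_mul] at h2
      exact (ENNReal.continuous_pow 2).continuousAt.tendsto.comp h2.enorm
    refine ENNReal.Tendsto.div tendsto_const_nhds (Or.inr ?_) h1 (Or.inl ?_)
    · simpa using one_sub_mul_ne_zero hl1.le hz'
    · simp
  rw [lintegral_congr_ae hlim]
  refine (lintegral_liminf_le fun n => by fun_prop).trans ?_
  exact liminf_le_of_le (by isBoundedDefault) fun b hb => by
    obtain ⟨n, hn⟩ := hb.exists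
    exact hn.trans (le_iSup₂_of_le (f := fun a (_ : a ∈ disc) =>
      ∫⁻ z, V μ z / ‖1 - a * z‖ₑ ^ 2 ∂area) _ (hmem n) le_rfl)

theorem memMD_log_of_lintegral_V_disc {μ : Measure ℂ}
    (h : (⨆ a ∈ disc, ∫⁻ z, V μ z / ‖1 - a * z‖ₑ ^ 2 ∂area) < ⊤) :
    MemMD μ fun z : ℂ => Complex.log (1 - z) := by
  obtain ⟨z₀, hz₀, hV⟩ := exists_V_ne_top h
  have := sFinite_restrict_of_V_ne_top (mem_disc.1 hz₀) hV
  obtain ⟨C, hC, hb⟩ := lintegral_U_comp_le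
  refine memMD_log_iff.2 ⟨_, ENNReal.mul_ne_top hC (ENNReal.add_ne_top.2
    ⟨(lintegral_V_circle_lt_top_of_disc h).ne, h.ne⟩), fun φ hφ => ?_⟩
  obtain ⟨l, hl, a, ha, hle⟩ := hb μ φ hφ
  refine hle.trans (mul_le_mul_right (add_le_add ?_ ?_) _)
  · exact le_iSup₂_of_le (f := fun l (_ : l ∈ circle) =>
      ∫⁻ z, V μ z / ‖1 - l * z‖ₑ ^ 2 ∂area) l hl le_rfl
  · exact le_iSup₂_of_le (f := fun a (_ : a ∈ disc) =>
      ∫⁻ z, V μ z / ‖1 - a * z‖ₑ ^ 2 ∂area) a ha le_rfl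

end HilbertMatrix

open HilbertMatrix

theorem theorem1p2 (μ : Measure ℂ) :
    List.TFAE [
      ∀ f : ℂ → ℂ, MemHInfty f → MemMD μ (hilbert f),
      MemMD μ (fun z : ℂ => Complex.log (1 - z)),
      (⨆ l ∈ circle, ∫⁻ z, V μ z / ‖1 - l * z‖ₑ ^ 2 ∂area) < ⊤,
      (⨆ a ∈ disc, ∫⁻ z, V μ z / ‖1 - a * z‖ₑ ^ 2 ∂area) < ⊤] := by
  tfae_have 1 ↔ 2 := hilbert_memMD_iff μ
  tfae_have 2 → 3 := MemMD.lintegral_V_circle_lt_top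
  tfae_have 3 → 4 := lintegral_V_disc_lt_top_of_circle
  tfae_have 4 → 2 := memMD_log_of_lintegral_V_disc
  tfae_finish
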